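/- Let $N,d,K\ge 0$ be integers with $N>d+1$, let $\Sigma_x\in\mathbb R^{d\times d}$ be symmetric positive definite, let $w_m^*,w_1^*,\dots,w_K^*\in\mathbb R^d$, let $\sigma_m,\sigma_1,\dots,\sigma_K\ge 0$, and let $\lambda_1,\dots,\lambda_K\ge 0$ with $\Lambda=\sum_{k=1}^K\lambda_k$. Let $X\in\mathbb R^{N\times d}$ have i.i.d. rows distributed as $\mathcal N(0,\Sigma_x)$. For each task $t\in\{m,1,\dots,K\}$ let $Y_t=Xw_t^*+\epsilon_t$, where $\epsilon_t\in\mathbb R^N$ has i.i.d. $\mathcal N(0,\sigma_t^2)$ entries, and let $y_m=x^\top w_m^*+\epsilon$ with a fresh feature $x\sim\mathcal N(0,\Sigma_x)$ and a fresh noise $\epsilon\sim\mathcal N(0,\sigma_m^2)$; here $X,\epsilon_m,\epsilon_1,\dots,\epsilon_K,x,\epsilon$ are mutually independent. Let $\hat w_D$ be a random vector that almost surely minimizes $$w\mapsto \|Xw-Y_m\|^2+\sum_{k=1}^K\lambda_k\|Xw-Y_k\|^2$$ over $\mathbb R^d$, and let $E_K=\mathbb E\big[(x^\top\hat w_D-y_m)^2\big]$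 be the expected main-task generalization error. Then $\hat w_D$, $(x^\top\hat w_D-y_m)^2$ and $(x^\top(\hat w_D-\bar w))^2$, where $\bar w=\mathbb E[\hat w_D]$, are integrable, and $$E_K=\underbrace{\mathbb E\big[(x^\top(\hat w_D-\bar w))^2\big]}_{\text{variance}}+\underbrace{\mathbb E\big[(x^\top(\bar w-w_m^*))^2\big]}_{\text{bias}}+\underbrace{\mathbb E\big[(x^\top w_m^*-y_m)^2\big]}_{\text{noise}}.$$ If $\Lambda>0$, then, with $w^*_{\mathrm{aux}}=\frac1\Lambda\sum_{k=1}^K\lambda_kw_k^*$, the variance, bias and noise are, in this order, the three terms of $$E_K=\frac{\sigma_m^2+\sum_{k=1}^K\lambda_k^2\sigma_k^2}{(1+\Lambda)^2}\,\frac{d}{N-d-1}+\Big(\frac{\Lambda}{1+\Lambda}\Big)^2\big\|\Sigma_x^{1/2}(w^*_{\mathrm{aux}}-w_m^*)\big\|^2+\sigma_m^2 .$$ If $K=0$ or $\Lambda=0$ (only the main task is learned), the variance, bias and noise are, in this order, the three terms of $$E_0=\sigma_m^2\,\frac{d}{N-d-1}+0+\sigma_m^2 .$$ -/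

import Mathlib

open MeasureTheory ProbabilityTheory
open scoped NNReal RealInnerProductSpace MatrixOrder

noncomputable section

namespace AuxOLS

/-- A training set: shared features `X` (given by its `N` rows), the main labels and the labels of
the `K` auxiliary tasks. -/
structure TrainingSet (N d K : ℕ) where
  X : Fin N → EuclideanSpace ℝ (Fin d)
  Ym : EuclideanSpace ℝ (Fin N)
  Yaux : Fin K → EuclideanSpace ℝ (Fin N)

/-- The product `X w ∈ ℝ^N` of the matrix with rows `X i` and the vector `w`. -/
def predict {N d : ℕ} (X : Fin N → EuclideanSpace ℝ (Fin d)) (w : EuclideanSpace ℝ (Fin d)) :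
    EuclideanSpace ℝ (Fin N) :=
  WithLp.toLp 2 (Matrix.mulVec (Matrix.of fun i j => X i j) w.ofLp)

/-- Labels generated by the linear model `X w + ε`. -/
def labels {N d : ℕ} (X : Fin N → EuclideanSpace ℝ (Fin d)) (w : EuclideanSpace ℝ (Fin d))
    (ε : Fin N → ℝ) : EuclideanSpace ℝ (Fin N) :=
  predict X w + WithLp.toLp 2 ε

/-- The training set generated from the features, the true models and the label noises. -/
def generate {N d K : ℕ} (wm : EuclideanSpace ℝ (Fin d)) (waux : Fin K → EuclideanSpace ℝ (Fin d))
    (X : Fin N → EuclideanSpace ℝ (Fin d)) (εm : Fin N → ℝ) (εaux : Fin K → Fin N → ℝ) :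
    TrainingSet N d K where
  X := X
  Ym := labels X wm εm
  Yaux := fun k => labels X (waux k) (εaux k)

/-- The weighted loss `‖X w - Y_m‖² + ∑ₖ λₖ ‖X w - Yₖ‖²`. -/
def loss {N d K : ℕ} (lam : Fin K → ℝ) (D : TrainingSet N d K) (w : EuclideanSpace ℝ (Fin d)) : ℝ :=
  ‖predict D.X w - D.Ym‖ ^ 2 + ∑ k, lam k * ‖predict D.X w - D.Yaux k‖ ^ 2

/-- Joint law of (features, main noise, auxiliary noises, fresh feature, fresh noise): everything
is independent, rows of the features and the fresh feature are `N(0, S)`, and the noises of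
each task have independent entries `N(0, σ²)`, with `σ` the standard deviation of that task. -/
def jointLaw (N : ℕ) {d K : ℕ} (S : Matrix (Fin d) (Fin d) ℝ) (σm : ℝ≥0) (σaux : Fin K → ℝ≥0) :
    Measure ((Fin N → EuclideanSpace ℝ (Fin d)) × (Fin N → ℝ) × (Fin K → Fin N → ℝ) ×
      EuclideanSpace ℝ (Fin d) × ℝ) :=
  (Measure.pi fun _ : Fin N => multivariateGaussian 0 S).prod <|
    (Measure.pi fun _ : Fin N => gaussianReal 0 (σm ^ 2)).prod <|
      (Measure.pi fun k : Fin K => Measure.pi fun _ : Fin N => gaussianReal 0 (σaux k ^ 2)).prod <|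
        (multivariateGaussian 0 S).prod (gaussianReal 0 (σm ^ 2))

variable {Ω : Type*} [MeasurableSpace Ω] {d : ℕ}

/-- Expected generalization error `𝔼 (xᵀ ŵ - y)²` of the random estimator `ŵ`. -/
def genError (P : Measure Ω) (what x : Ω → EuclideanSpace ℝ (Fin d)) (y : Ω → ℝ) : ℝ :=
  ∫ ω, (⟪x ω, what ω⟫ - y ω) ^ 2 ∂P

/-- Variance `𝔼 (xᵀ (ŵ - 𝔼 ŵ))²`. -/
def varianceTerm (P : Measure Ω) (what x : Ω → EuclideanSpace ℝ (Fin d)) : ℝ :=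
  ∫ ω, ⟪x ω, what ω - ∫ ω', what ω' ∂P⟫ ^ 2 ∂P

/-- Bias `𝔼 (xᵀ (𝔼 ŵ - w_m))²`. -/
def biasTerm (P : Measure Ω) (what x : Ω → EuclideanSpace ℝ (Fin d))
    (wm : EuclideanSpace ℝ (Fin d)) : ℝ :=
  ∫ ω, ⟪x ω, (∫ ω', what ω' ∂P) - wm⟫ ^ 2 ∂P

/-- Noise `𝔼 (xᵀ w_m - y)²`. -/
def noiseTerm (P : Measure Ω) (x : Ω → EuclideanSpace ℝ (Fin d)) (y : Ω → ℝ)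
    (wm : EuclideanSpace ℝ (Fin d)) : ℝ :=
  ∫ ω, (⟪x ω, wm⟫ - y ω) ^ 2 ∂P

/-- The vector `S^{1/2} v`, with the positive semidefinite square root of `S`. -/
def sqrtApply (S : Matrix (Fin d) (Fin d) ℝ) (v : EuclideanSpace ℝ (Fin d)) :
    EuclideanSpace ℝ (Fin d) :=
  Matrix.toEuclideanCLM (𝕜 := ℝ) (CFC.sqrt S) v

end AuxOLS

end

/-!
Completing the square turns the weighted loss into `(1 + Λ) ‖X w - Ȳ‖²` plus a constant, where `Ȳ`
is the weighted average of the label vectors. Hence `ŵ` is the ordinary least squares estimator of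
the pooled linear model: `ŵ = w̄ + (XᵀX)⁻¹Xᵀη`, where `w̄` is the same weighted average of the
true models and `η` is white noise of variance `τ = (σ_m² + ∑ₖ λₖ² σₖ²) / (1 + Λ)²` independent of
`X`. So `𝔼 ŵ = w̄`, which gives the bias, and the variance is `τ` times `𝔼 tr (S (XᵀX)⁻¹)`.

Whitening `X = C S^{1/2}` reduces this trace to `tr (CᵀC)⁻¹`, with `C` a matrix of independent
standard Gaussian entries. The `j`-th diagonal entry of `(CᵀC)⁻¹` is the inverse of the squared
distance from the `j`-th column to the span of the other `d - 1` columns. Conditionally on these,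
that squared distance is chi-square with `N - d + 1` degrees of freedom, so its inverse has mean
`1 / (N - d - 1)`.
-/

namespace AuxOLS

open Matrix Module Submodule

/-! ### The mean of an inverse chi-square variable -/

section InverseChiSquare

lemma integral_exp_neg_mul_sq_gaussianReal {t : ℝ} (ht : 0 ≤ t) :
    ∫ x, Real.exp (-t * x ^ 2) ∂gaussianReal 0 1 = (1 + 2 * t) ^ (-(1 / 2) : ℝ) := by
  have hpdf (x : ℝ) : gaussianPDFReal 0 1 x • Real.exp (-t * x ^ 2) =
      (√(2 * Real.pi))⁻¹ * Real.exp (-(t + 1 / 2) * x ^ 2) := by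
    simp only [gaussianPDFReal, smul_eq_mul, NNReal.coe_one, mul_one, sub_zero, mul_assoc,
      ← Real.exp_add]
    ring_nf
  simp_rw [integral_gaussianReal_eq_integral_smul one_ne_zero, hpdf, integral_const_mul,
    integral_gaussian]
  rw [← Real.sqrt_inv, ← Real.sqrt_mul (by positivity), Real.rpow_neg (by positivity),
    ← Real.sqrt_eq_rpow, ← Real.sqrt_inv]
  congr 1
  have := Real.pi_ne_zero
  field_simp
  ring

lemma lintegral_Ioi_exp_neg_mul {a : ℝ} (ha : 0 ≤ a) :
    ∫⁻ t in Set.Ioi (0 : ℝ), ENNReal.ofReal (Real.exp (-t * a)) = (ENNReal.ofReal a)⁻¹ := by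
  rcases ha.eq_or_lt with rfl | ha
  · simp
  simp_rw [show ∀ t : ℝ, -t * a = -a * t by intro t; ring]
  rw [← ofReal_integral_eq_lintegral_ofReal (integrableOn_exp_mul_Ioi (by linarith) 0)
    (ae_of_all _ fun _ => by positivity), integral_exp_mul_Ioi (by linarith),
    ← ENNReal.ofReal_inv_of_pos ha]
  simp

lemma lintegral_Ioi_one_add_two_mul_rpow {q : ℝ} (hq : 1 < q) :
    ∫⁻ t in Set.Ioi (0 : ℝ), ENNReal.ofReal ((1 + 2 * t) ^ (-q)) =
      ENNReal.ofReal (1 / (2 * (q - 1))) := by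
  let F (t : ℝ) : ℝ := -(1 / (2 * (q - 1))) * (1 + 2 * t) ^ (-(q - 1))
  have hF : ∀ t ∈ Set.Ici (0 : ℝ), HasDerivAt F ((1 + 2 * t) ^ (-q)) t := fun t ht => by
    have ht : (0 : ℝ) ≤ t := ht
    have haff : HasDerivAt (fun t : ℝ => 1 + 2 * t) 2 t := by
      simpa using ((hasDerivAt_id t).const_mul 2).const_add 1
    convert! (haff.rpow_const (p := -(q - 1)) (Or.inl (by positivity))).const_mul
      (-(1 / (2 * (q - 1)))) using 1
    have : q - 1 ≠ 0 := by linarith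
    rw [show -(q - 1) - 1 = -q by ring]
    field_simp
  have hpos : ∀ t ∈ Set.Ioi (0 : ℝ), 0 ≤ (1 + 2 * t) ^ (-q) := fun t ht => by
    have : (0 : ℝ) < t := ht
    positivity
  have hlim : Filter.Tendsto F Filter.atTop (nhds 0) := by
    have haff : Filter.Tendsto (fun t : ℝ => 1 + 2 * t) Filter.atTop Filter.atTop :=
      Filter.tendsto_atTop_add_const_left _ _
        (Filter.tendsto_id.const_mul_atTop (by norm_num : (0 : ℝ) < 2))
    simpa only [Function.comp_def, mul_zero] using
      ((tendsto_rpow_neg_atTop (by linarith : 0 < q - 1)).comp haff).const_mul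
        (-(1 / (2 * (q - 1))))
  rw [← ofReal_integral_eq_lintegral_ofReal (integrableOn_Ioi_deriv_of_nonneg' hF hpos hlim)
    (ae_restrict_of_forall_mem measurableSet_Ioi hpos),
    integral_Ioi_of_hasDerivAt_of_nonneg' hF hpos hlim]
  simp [F]

variable {E : Type*} [NormedAddCommGroup E] [InnerProductSpace ℝ E] [FiniteDimensional ℝ E]
  [MeasurableSpace E] [BorelSpace E]

lemma integral_exp_neg_mul_norm_sq_stdGaussian {t : ℝ} (ht : 0 ≤ t) :
    ∫ g, Real.exp (-t * ‖g‖ ^ 2) ∂stdGaussian E =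
      (1 + 2 * t) ^ (-(finrank ℝ E / 2 : ℝ)) := by
  let b := stdOrthonormalBasis ℝ E
  have hprod (x : Fin (finrank ℝ E) → ℝ) : Real.exp (-t * ‖∑ i, x i • b i‖ ^ 2) =
      ∏ i, Real.exp (-t * x i ^ 2) := by
    rw [← Real.exp_sum, ← Finset.mul_sum, ← real_inner_self_eq_norm_sq,
      b.orthonormal.inner_sum]
    simp [sq]
  rw [stdGaussian_eq_map_pi_orthonormalBasis b,
    integral_map (Measurable.aemeasurable (by fun_prop))
      (Measurable.aestronglyMeasurable (by fun_prop))]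
  simp_rw [hprod]
  rw [integral_fintype_prod_eq_prod (f := fun _ x => Real.exp (-t * x ^ 2))]
  simp only [integral_exp_neg_mul_sq_gaussianReal ht, Finset.prod_const, Finset.card_univ,
    Fintype.card_fin]
  rw [← Real.rpow_natCast, ← Real.rpow_mul (by positivity)]
  ring_nf

lemma lintegral_inv_norm_sq_stdGaussian (hE : 2 < finrank ℝ E) :
    ∫⁻ g, (ENNReal.ofReal (‖g‖ ^ 2))⁻¹ ∂stdGaussian E =
      ENNReal.ofReal (1 / ((finrank ℝ E : ℝ) - 2)) := by
  have hE' : (2 : ℝ) < finrank ℝ E := by exact_mod_cast hE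
  -- `1 / a = ∫₀^∞ exp (-t a) dt` reduces the claim to the Laplace transform of `‖g‖²`.
  simp_rw [← lintegral_Ioi_exp_neg_mul (sq_nonneg ‖_‖)]
  rw [lintegral_lintegral_swap (Measurable.aemeasurable (by fun_prop)),
    show (finrank ℝ E : ℝ) - 2 = 2 * (finrank ℝ E / 2 - 1) by ring,
    ← lintegral_Ioi_one_add_two_mul_rpow (by linarith)]
  refine setLIntegral_congr_fun measurableSet_Ioi fun t ht => ?_
  have ht : (0 : ℝ) < t := ht
  rw [← integral_exp_neg_mul_norm_sq_stdGaussian ht.le, ofReal_integral_eq_lintegral_ofReal _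
    (ae_of_all _ fun _ => by positivity)]
  refine Integrable.of_bound (Measurable.aestronglyMeasurable (by fun_prop)) 1
    (ae_of_all _ fun g => ?_)
  rw [Real.norm_eq_abs, Real.abs_exp, Real.exp_le_one_iff, neg_mul, neg_nonpos]
  positivity

end InverseChiSquare

/-! ### Gram matrices of independent Gaussian vectors -/

section StdGaussian

variable {E : Type*} [NormedAddCommGroup E] [InnerProductSpace ℝ E] [FiniteDimensional ℝ E]
  [MeasurableSpace E] [BorelSpace E]

lemma map_orthogonalProjectionOnto_stdGaussian (V : Submodule ℝ E) :
    (stdGaussian E).map V.orthogonalProjectionOnto = stdGaussian V := by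
  apply Measure.ext_of_charFun
  ext t
  rw [charFun_stdGaussian, charFun_apply, integral_map (by fun_prop)
    (Measurable.aestronglyMeasurable (by fun_prop))]
  simp_rw [inner_orthogonalProjectionOnto_eq_of_mem_right]
  rw [← charFun_apply, charFun_stdGaussian]
  rfl

lemma stdGaussian_submodule_eq_zero {V : Submodule ℝ E} (hV : V ≠ ⊤) :
    stdGaussian E (V : Set E) = 0 := by
  obtain ⟨v, hv, hv0⟩ := exists_mem_ne_zero_of_ne_bot (mt V.orthogonal_eq_bot_iff.1 hV)
  have hsub : (V : Set E) ⊆ innerSL ℝ v ⁻¹' {0} := fun g hg => by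
    simpa [real_inner_comm] using hv g hg
  refine measure_mono_null hsub ?_
  rw [← Measure.map_apply (by fun_prop) (measurableSet_singleton 0),
    IsGaussian.map_eq_gaussianReal, variance_dual_stdGaussian, innerSL_apply_norm]
  have : NullSingletonClass (gaussianReal ((stdGaussian E)[innerSL ℝ v]) (‖v‖ ^ 2).toNNReal) :=
    nullSingletonClass_gaussianReal (by simp [hv0])
  exact measure_singleton 0

lemma ae_linearIndependent_insertNth {n : ℕ} (hn : n < finrank ℝ E) {c : Fin n → E}
    (hc : LinearIndependent ℝ c) (j : Fin (n + 1)) :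
    ∀ᵐ g ∂stdGaussian E, LinearIndependent ℝ (j.insertNth g c : Fin (n + 1) → E) := by
  have hspan : span ℝ (Set.range c) ≠ ⊤ := fun h => by
    have := finrank_span_eq_card hc
    rw [h, finrank_top, Fintype.card_fin] at this
    omega
  filter_upwards [measure_eq_zero_iff_ae_notMem.1 (stdGaussian_submodule_eq_zero hspan)] with g hg
  rw [← Fin.cons_comp_cycleRange, linearIndependent_equiv]
  exact linearIndependent_finCons.2 ⟨hc, hg⟩

end StdGaussian

section MeasurableMatrix

variable {α n : Type*} [MeasurableSpace α] [Fintype n] [DecidableEq n] {f : α → Matrix n n ℝ}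

lemma measurable_det (hf : ∀ i j, Measurable fun a => f a i j) :
    Measurable fun a => (f a).det := by
  simp only [det_apply]
  fun_prop

lemma measurable_inv_apply (hf : ∀ i j, Measurable fun a => f a i j) (i j : n) :
    Measurable fun a => (f a)⁻¹ i j := by
  simp only [inv_def, Ring.inverse_eq_inv', Matrix.smul_apply, smul_eq_mul, adjugate_apply]
  refine (measurable_det hf).inv.mul (measurable_det fun k l => ?_)
  rcases eq_or_ne k j with rfl | hk
  · simp
  · simpa [updateRow_ne hk] using hf k l

end MeasurableMatrix

section Gram

variable {E : Type*} [NormedAddCommGroup E] [InnerProductSpace ℝ E] [FiniteDimensional ℝ E]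

lemma inv_gram_apply_self_mul_norm_sq {ι : Type*} [Fintype ι] [DecidableEq ι] {c : ι → E}
    (hc : LinearIndependent ℝ c) (j : ι) :
    (gram ℝ c)⁻¹ j j * ‖(span ℝ (c '' {j}ᶜ))ᗮ.orthogonalProjectionOnto (c j)‖ ^ 2 = 1 := by
  set V := span ℝ (c '' {j}ᶜ)
  set a : ι → ℝ := fun i => (gram ℝ c)⁻¹ i j
  have hmem {i : ι} (hi : i ≠ j) : c i ∈ V := subset_span ⟨i, hi, rfl⟩
  -- `∑ i, a i • c i` is the vector dual to `c j` in the span of the family.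
  have hdual (i : ι) : ⟪c i, ∑ k, a k • c k⟫ = if i = j then 1 else 0 := by
    have hdet : IsUnit (gram ℝ c).det :=
      isUnit_iff_ne_zero.2 (det_gram_ne_zero_iff_linearIndependent.2 hc)
    rw [← one_apply, ← mul_nonsing_inv _ hdet, mul_apply, inner_sum]
    simp [a, inner_smul_right, mul_comm]
  have hperp : ∑ k, a k • c k ∈ Vᗮ := (mem_orthogonal _ _).2 fun u hu => by
    induction hu using span_induction with
    | mem u hu =>
      obtain ⟨i, hi, rfl⟩ := hu
      exact (hdual i).trans (if_neg hi)
    | zero => exact inner_zero_left _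
    | add u v _ _ hu hv => rw [inner_add_left, hu, hv, add_zero]
    | smul r u _ hu => rw [real_inner_smul_left, hu, mul_zero]
  have hproj : (⟨∑ k, a k • c k, hperp⟩ : Vᗮ) = a j • Vᗮ.orthogonalProjectionOnto (c j) := by
    rw [← Vᗮ.orthogonalProjectionOnto_mem_subspace_eq_self ⟨_, hperp⟩, map_sum,
      Finset.sum_eq_single j _ (by simp), map_smul]
    intro i _ hi
    rw [map_smul, orthogonalProjectionOnto_eq_zero_iff.2 (le_orthogonal_orthogonal _ (hmem hi)),
      smul_zero]
  calc a j * ‖Vᗮ.orthogonalProjectionOnto (c j)‖ ^ 2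
      = ⟪Vᗮ.orthogonalProjectionOnto (c j), (⟨∑ k, a k • c k, hperp⟩ : Vᗮ)⟫ := by
        rw [hproj, inner_smul_right, real_inner_self_eq_norm_sq]
    _ = ⟪c j, ∑ k, a k • c k⟫ := inner_orthogonalProjectionOnto_eq_of_mem_right _ _
    _ = 1 := by rw [hdual, if_pos rfl]

variable [MeasurableSpace E] [BorelSpace E]

lemma measurable_inv_gram_apply {n : ℕ} (i j : Fin n) :
    Measurable fun c : Fin n → E => (gram ℝ c)⁻¹ i j :=
  measurable_inv_apply (fun k l => by simp only [gram_apply]; fun_prop) i j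

lemma measurableSet_linearIndependent (n : ℕ) :
    MeasurableSet {c : Fin n → E | LinearIndependent ℝ c} := by
  simp_rw [← det_gram_ne_zero_iff_linearIndependent (𝕜 := ℝ)]
  exact (measurableSet_singleton (0 : ℝ)).compl.preimage
    (measurable_det fun i j => by simp only [gram_apply]; fun_prop)

lemma ae_linearIndependent_stdGaussian {n : ℕ} (hn : n ≤ finrank ℝ E) :
    ∀ᵐ c ∂(Measure.pi fun _ : Fin n => stdGaussian E), LinearIndependent ℝ c := by
  induction n with
  | zero => exact ae_of_all _ fun c => linearIndependent_empty_type
  | succ n ih =>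
    have hmp := (measurePreserving_piFinSuccAbove (fun _ : Fin (n + 1) => stdGaussian E) 0).symm
    have hmeas := hmp.measurable (measurableSet_linearIndependent (E := E) (n + 1))
    rw [← hmp.map_eq, ae_map_iff hmp.measurable.aemeasurable (measurableSet_linearIndependent _)]
    refine (Measure.ae_prod_iff_ae_ae hmeas).2 (Measure.ae_ae_comm (p := fun g c =>
      LinearIndependent ℝ ((0 : Fin (n + 1)).insertNth g c : Fin (n + 1) → E)) hmeas |>.2 ?_)
    filter_upwards [ih (by omega)] with c hc
    exact ae_linearIndependent_insertNth hn hc 0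

lemma lintegral_inv_gram_insertNth_apply_self {n : ℕ} (hn : n + 2 < finrank ℝ E) {c : Fin n → E}
    (hc : LinearIndependent ℝ c) (j : Fin (n + 1)) :
    ∫⁻ g, ENNReal.ofReal ((gram ℝ (j.insertNth g c : Fin (n + 1) → E))⁻¹ j j) ∂stdGaussian E =
      ENNReal.ofReal (1 / ((finrank ℝ E : ℝ) - n - 2)) := by
  set V := span ℝ (Set.range c)
  have hrank : finrank ℝ E = n + finrank ℝ Vᗮ := by
    rw [← V.finrank_add_finrank_orthogonal, finrank_span_eq_card hc, Fintype.card_fin]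
  calc _ = ∫⁻ g, (ENNReal.ofReal (‖Vᗮ.orthogonalProjectionOnto g‖ ^ 2))⁻¹ ∂stdGaussian E := by
        refine lintegral_congr_ae ?_
        filter_upwards [ae_linearIndependent_insertNth (by omega) hc j] with g hg
        have hV : span ℝ ((j.insertNth g c : Fin (n + 1) → E) '' {j}ᶜ) = V := by
          rw [← Fin.range_succAbove, ← Set.range_comp]
          congr 2
          ext i
          simp
        have h := inv_gram_apply_self_mul_norm_sq hg j
        rw [hV, Fin.insertNth_apply_same] at h
        refine ENNReal.eq_inv_of_mul_eq_one_left ?_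
        rw [← ENNReal.ofReal_mul' (by positivity), h, ENNReal.ofReal_one]
    _ = ∫⁻ g, (ENNReal.ofReal (‖g‖ ^ 2))⁻¹ ∂stdGaussian Vᗮ := by
        rw [← map_orthogonalProjectionOnto_stdGaussian, lintegral_map (by fun_prop) (by fun_prop)]
    _ = _ := by
        rw [lintegral_inv_norm_sq_stdGaussian (by omega), hrank, Nat.cast_add, add_sub_cancel_left]

lemma lintegral_inv_gram_apply_self {n : ℕ} (hn : n + 1 < finrank ℝ E) (j : Fin n) :
    ∫⁻ c, ENNReal.ofReal ((gram ℝ c)⁻¹ j j) ∂(Measure.pi fun _ : Fin n => stdGaussian E) =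
      ENNReal.ofReal (1 / ((finrank ℝ E : ℝ) - n - 1)) := by
  rcases n with _ | n
  · exact j.elim0
  have hmp := (measurePreserving_piFinSuccAbove (fun _ : Fin (n + 1) => stdGaussian E) j).symm
  have hmeas := (measurable_inv_gram_apply (E := E) j j).ennreal_ofReal
  rw [← hmp.map_eq, lintegral_map hmeas hmp.measurable]
  refine (lintegral_prod_symm' _ (hmeas.comp hmp.measurable)).trans ?_
  calc _ = ∫⁻ _ : Fin n → E, ENNReal.ofReal (1 / ((finrank ℝ E : ℝ) - n - 2))
        ∂(Measure.pi fun _ => stdGaussian E) := by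
        refine lintegral_congr_ae ?_
        filter_upwards [ae_linearIndependent_stdGaussian (E := E) (n := n) (by omega)] with c hc
        exact lintegral_inv_gram_insertNth_apply_self hn hc j
    _ = _ := by
        rw [lintegral_const, measure_univ, mul_one]
        push_cast
        ring_nf

lemma integrable_inv_gram_apply_self {n : ℕ} (hn : n + 1 < finrank ℝ E) (j : Fin n) :
    Integrable (fun c => (gram ℝ c)⁻¹ j j) (Measure.pi fun _ : Fin n => stdGaussian E) := by
  refine ⟨(measurable_inv_gram_apply j j).aestronglyMeasurable, ?_⟩
  rw [hasFiniteIntegral_iff_ofReal (ae_of_all _ fun c => (posSemidef_gram ℝ c).inv.diag_nonneg),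
    lintegral_inv_gram_apply_self hn]
  exact ENNReal.ofReal_lt_top

lemma integral_trace_inv_gram_stdGaussian {n : ℕ} (hn : n + 1 < finrank ℝ E) :
    ∫ c, ((gram ℝ c)⁻¹).trace ∂(Measure.pi fun _ : Fin n => stdGaussian E) =
      n / ((finrank ℝ E : ℝ) - n - 1) := by
  have hpos : (0 : ℝ) < (finrank ℝ E : ℝ) - n - 1 := by
    have : ((n + 1 : ℕ) : ℝ) < finrank ℝ E := by exact_mod_cast hn
    push_cast at this
    linarith
  have hdiag (j : Fin n) : ∫ c, (gram ℝ c)⁻¹ j j ∂(Measure.pi fun _ : Fin n => stdGaussian E) =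
      1 / ((finrank ℝ E : ℝ) - n - 1) := by
    rw [integral_eq_lintegral_of_nonneg_ae
      (ae_of_all _ fun c => (posSemidef_gram ℝ c).inv.diag_nonneg)
      (measurable_inv_gram_apply j j).aestronglyMeasurable, lintegral_inv_gram_apply_self hn,
      ENNReal.toReal_ofReal (by positivity)]
  simp only [trace, diag_apply]
  rw [integral_finsetSum _ fun j _ => integrable_inv_gram_apply_self hn j]
  simp only [hdiag, Finset.sum_const, Finset.card_univ, Fintype.card_fin, nsmul_eq_mul]
  ring

end Gram

/-! ### The least squares matrix of a Gaussian design -/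

section OLSMatrix

variable {m n : Type*} [Fintype m] {Ω : Type*} [MeasurableSpace Ω] {P : Measure Ω}
  {A : Ω → Matrix m n ℝ}

lemma measurable_transpose_mul_self_apply (hA : ∀ i j, Measurable fun ω => A ω i j) (j k : n) :
    Measurable fun ω => ((A ω)ᵀ * A ω) j k := by
  simp only [mul_apply, transpose_apply]
  fun_prop

variable [Fintype n] [DecidableEq n]

/-- The matrix `(AᵀA)⁻¹Aᵀ` of the ordinary least squares estimator with design matrix `A`. It is
`0` when `AᵀA` is singular. -/
noncomputable def olsMatrix (A : Matrix m n ℝ) : Matrix n m ℝ := (Aᵀ * A)⁻¹ * Aᵀ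

lemma olsMatrix_mul_transpose (A : Matrix m n ℝ) :
    olsMatrix A * (olsMatrix A)ᵀ = (Aᵀ * A)⁻¹ := by
  have hsymm : (Aᵀ * A)ᵀ = Aᵀ * A := by rw [transpose_mul, transpose_transpose]
  rw [olsMatrix, transpose_mul, transpose_transpose, transpose_nonsing_inv, hsymm,
    Matrix.mul_assoc, ← Matrix.mul_assoc Aᵀ]
  by_cases h : IsUnit (Aᵀ * A).det
  · rw [mul_nonsing_inv _ h, Matrix.mul_one]
  · simp only [nonsing_inv_apply_not_isUnit _ h, Matrix.zero_mul]

lemma olsMatrix_mul (A : Matrix m n ℝ) {B : Matrix n n ℝ} (hB : IsUnit B.det) :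
    olsMatrix (A * B) = B⁻¹ * olsMatrix A := by
  simp only [olsMatrix, transpose_mul, Matrix.mul_assoc]
  rw [← Matrix.mul_assoc Aᵀ, ← Matrix.mul_assoc Bᵀ, Matrix.mul_inv_rev, Matrix.mul_inv_rev]
  simp only [Matrix.mul_assoc, nonsing_inv_mul_cancel_left _ _ (isUnit_det_transpose B hB)]

lemma trace_mul_inv_transpose_mul_self (A : Matrix m n ℝ) {B : Matrix n n ℝ} (hB : IsUnit B.det) :
    (Bᵀ * B * ((A * B)ᵀ * (A * B))⁻¹).trace = ((Aᵀ * A)⁻¹).trace := by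
  rw [← olsMatrix_mul_transpose, olsMatrix_mul A hB, transpose_mul, Matrix.mul_assoc Bᵀ,
    trace_mul_comm]
  simp only [Matrix.mul_assoc, mul_nonsing_inv_cancel_left _ _ hB]
  rw [← transpose_mul, mul_nonsing_inv _ hB, transpose_one, Matrix.mul_one,
    olsMatrix_mul_transpose]

lemma measurable_olsMatrix_apply (hA : ∀ i j, Measurable fun ω => A ω i j) (j : n) (i : m) :
    Measurable fun ω => olsMatrix (A ω) j i := by
  simp only [olsMatrix, mul_apply (M := (_)⁻¹), transpose_apply]
  exact Finset.measurable_sum _ fun k _ =>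
    (measurable_inv_apply (measurable_transpose_mul_self_apply hA) j k).mul (hA i k)

lemma memLp_two_olsMatrix_apply (hA : ∀ i j, Measurable fun ω => A ω i j) {j : n}
    (hint : Integrable (fun ω => ((A ω)ᵀ * A ω)⁻¹ j j) P) (i : m) :
    MemLp (fun ω => olsMatrix (A ω) j i) 2 P := by
  have hmeas := measurable_olsMatrix_apply hA j i
  refine (memLp_two_iff_integrable_sq hmeas.aestronglyMeasurable).2
    (hint.mono' (hmeas.pow_const 2).aestronglyMeasurable (ae_of_all _ fun ω => ?_))
  rw [← olsMatrix_mul_transpose, mul_apply, Real.norm_eq_abs, abs_sq, sq]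
  exact Finset.single_le_sum (f := fun i => olsMatrix (A ω) j i * (olsMatrix (A ω))ᵀ i j)
    (fun i _ => mul_self_nonneg _) (Finset.mem_univ i)

end OLSMatrix

section IntegralTrace

variable {n Ω : Type*} [Fintype n] [MeasurableSpace Ω] {P : Measure Ω} {M : Ω → Matrix n n ℝ}

lemma integrable_trace_mul (hM : ∀ j k, Integrable (fun ω => M ω j k) P) (S : Matrix n n ℝ) :
    Integrable (fun ω => (S * M ω).trace) P := by
  simp only [trace, diag_apply, mul_apply]
  exact integrable_finsetSum _ fun j _ => integrable_finsetSum _ fun k _ => (hM k j).const_mul _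

lemma integral_trace_mul (hM : ∀ j k, Integrable (fun ω => M ω j k) P) (S : Matrix n n ℝ) :
    ∫ ω, (S * M ω).trace ∂P = ∑ j, ∑ k, S j k * ∫ ω, M ω k j ∂P := by
  simp only [trace, diag_apply, mul_apply]
  have hint (j k) : Integrable (fun ω => S j k * M ω k j) P := (hM k j).const_mul _
  rw [integral_finsetSum _ fun j _ => integrable_finsetSum _ fun k _ => hint j k]
  refine Finset.sum_congr rfl fun j _ => ?_
  rw [integral_finsetSum _ fun k _ => hint j k]
  simp only [integral_const_mul]

end IntegralTrace

section GaussianDesign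

variable {N d : ℕ} {S : Matrix (Fin d) (Fin d) ℝ}

/-- The matrix with rows `X i`. -/
def design (X : Fin N → EuclideanSpace ℝ (Fin d)) : Matrix (Fin N) (Fin d) ℝ :=
  of fun i j => X i j

/-- The matrix with columns `c j`. -/
def ofColumns (c : Fin d → EuclideanSpace ℝ (Fin N)) : Matrix (Fin N) (Fin d) ℝ :=
  of fun i j => c j i

/-- The rows of the matrix `C S^{1/2}`, where `C` has columns `c j`: this turns `d` independent
standard Gaussian columns in `ℝ^N` into `N` independent `N(0, S)` rows in `ℝ^d`. -/
noncomputable def colored (S : Matrix (Fin d) (Fin d) ℝ) (c : Fin d → EuclideanSpace ℝ (Fin N)) :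
    Fin N → EuclideanSpace ℝ (Fin d) :=
  fun i => sqrtApply S (WithLp.toLp 2 fun j => c j i)

lemma gram_eq_transpose_mul_ofColumns (c : Fin d → EuclideanSpace ℝ (Fin N)) :
    gram ℝ c = (ofColumns c)ᵀ * ofColumns c := by
  simpa [ofColumns] using gram_eq_conjTranspose_mul (EuclideanSpace.basisFun (Fin N) ℝ) c

lemma transpose_sqrt : (CFC.sqrt S)ᵀ = CFC.sqrt S := by
  have h : (CFC.sqrt S).IsHermitian := (CFC.sqrt_nonneg S).isSelfAdjoint
  simpa using h.eq

lemma isUnit_det_sqrt (hS : S.PosDef) : IsUnit (CFC.sqrt S).det := by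
  refine isUnit_of_mul_isUnit_left (y := (CFC.sqrt S).det) ?_
  rw [← det_mul, CFC.sqrt_mul_sqrt_self S hS.posSemidef.nonneg]
  exact hS.det_pos.ne'.isUnit

lemma design_colored (c : Fin d → EuclideanSpace ℝ (Fin N)) :
    design (colored S c) = ofColumns c * CFC.sqrt S := by
  ext i j
  rw [← transpose_sqrt]
  simp [design, colored, sqrtApply, ofColumns, mul_apply, mulVec, dotProduct, mul_comm]

lemma measurable_design_apply (i : Fin N) (j : Fin d) :
    Measurable fun X : Fin N → EuclideanSpace ℝ (Fin d) => design X i j := by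
  simp only [design, of_apply]
  fun_prop

lemma measurable_ofColumns_apply (i : Fin N) (j : Fin d) :
    Measurable fun c : Fin d → EuclideanSpace ℝ (Fin N) => ofColumns c i j := by
  simp only [ofColumns, of_apply]
  fun_prop

lemma measurable_colored : Measurable (colored (N := N) S) := by
  unfold colored sqrtApply
  fun_prop

lemma map_curry_pi {ι κ α : Type*} [Fintype ι] [Fintype κ] [MeasurableSpace α]
    (μ : Measure α) [IsProbabilityMeasure μ] :
    (Measure.pi fun _ : ι × κ => μ).map (fun x i j => x (i, j)) =
      Measure.pi fun _ : ι => Measure.pi fun _ : κ => μ := by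
  simp_rw [← Measure.infinitePi_eq_pi]
  exact Measure.infinitePi_map_curry (fun (_ : ι) (_ : κ) => μ)

lemma map_swap_pi_pi {ι κ α : Type*} [Fintype ι] [Fintype κ] [MeasurableSpace α]
    (μ : Measure α) [IsProbabilityMeasure μ] :
    (Measure.pi fun _ : ι => Measure.pi fun _ : κ => μ).map (fun x j i => x i j) =
      Measure.pi fun _ : κ => Measure.pi fun _ : ι => μ := by
  rw [← map_curry_pi, ← map_curry_pi (ι := κ),
    ← Measure.pi_map_piCongrLeft (Equiv.prodComm ι κ), Measure.map_map (by fun_prop) (by fun_prop),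
    Measure.map_map (by fun_prop) (by fun_prop)]
  rfl

lemma map_colored_pi_stdGaussian :
    (Measure.pi fun _ : Fin d => stdGaussian (EuclideanSpace ℝ (Fin N))).map (colored S) =
      Measure.pi fun _ : Fin N => multivariateGaussian 0 S := by
  simp_rw [multivariateGaussian, ← map_pi_eq_stdGaussian]
  rw [Measure.map_map (by fun_prop) (by fun_prop),
    ← Measure.pi_map_pi (hf := fun _ => Measurable.aemeasurable (by fun_prop)),
    ← Measure.pi_map_pi (hf := fun _ => Measurable.aemeasurable (by fun_prop)),
    ← map_swap_pi_pi (ι := Fin d), Measure.map_map measurable_colored (by fun_prop),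
    Measure.map_map (by fun_prop) (by fun_prop)]
  congr 1
  ext x i j
  simp [colored, sqrtApply]

lemma ae_det_transpose_mul_design_ne_zero (hS : S.PosDef) (hN : d ≤ N) :
    ∀ᵐ X ∂(Measure.pi fun _ : Fin N => multivariateGaussian 0 S),
      ((design X)ᵀ * design X).det ≠ 0 := by
  have hmeas : MeasurableSet {X : Fin N → EuclideanSpace ℝ (Fin d) |
      ((design X)ᵀ * design X).det ≠ 0} := (measurableSet_singleton (0 : ℝ)).compl.preimage
    (measurable_det (measurable_transpose_mul_self_apply measurable_design_apply))
  rw [← map_colored_pi_stdGaussian, ae_map_iff measurable_colored.aemeasurable hmeas]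
  filter_upwards [ae_linearIndependent_stdGaussian (E := EuclideanSpace ℝ (Fin N)) (n := d)
    (by simpa using hN)] with c hc
  have hR := (isUnit_det_sqrt hS).ne_zero
  rw [← det_gram_ne_zero_iff_linearIndependent (𝕜 := ℝ), gram_eq_transpose_mul_ofColumns] at hc
  rw [design_colored, transpose_mul, Matrix.mul_assoc, ← Matrix.mul_assoc _ (ofColumns c), det_mul,
    det_mul, det_transpose]
  exact mul_ne_zero hR (mul_ne_zero hc hR)

lemma memLp_olsMatrix_design_apply (hS : S.PosDef) (hN : d + 1 < N) (j : Fin d) (i : Fin N) :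
    MemLp (fun X => olsMatrix (design X) j i) 2
      (Measure.pi fun _ : Fin N => multivariateGaussian 0 S) := by
  rw [← map_colored_pi_stdGaussian, memLp_map_measure_iff
    (measurable_olsMatrix_apply measurable_design_apply j i).aestronglyMeasurable
    measurable_colored.aemeasurable]
  simp only [Function.comp_def, design_colored, olsMatrix_mul _ (isUnit_det_sqrt hS),
    mul_apply (M := (_)⁻¹)]
  refine memLp_finsetSum _ fun k _ => MemLp.const_mul ?_ _
  refine memLp_two_olsMatrix_apply measurable_ofColumns_apply ?_ i
  simp only [← gram_eq_transpose_mul_ofColumns]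
  exact integrable_inv_gram_apply_self (by simpa using hN) k

lemma integrable_inv_transpose_mul_design_apply (hS : S.PosDef) (hN : d + 1 < N) (j k : Fin d) :
    Integrable (fun X => ((design X)ᵀ * design X)⁻¹ j k)
      (Measure.pi fun _ : Fin N => multivariateGaussian 0 S) := by
  simp only [← olsMatrix_mul_transpose, mul_apply (M := olsMatrix _), transpose_apply]
  exact integrable_finsetSum _ fun i _ => (memLp_olsMatrix_design_apply hS hN j i).integrable_mul
    (memLp_olsMatrix_design_apply hS hN k i)

lemma sum_mul_integral_inv_transpose_mul_design (hS : S.PosDef) (hN : d + 1 < N) :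
    ∑ j, ∑ k, S j k * ∫ X, ((design X)ᵀ * design X)⁻¹ k j
      ∂(Measure.pi fun _ : Fin N => multivariateGaussian 0 S) = d / ((N : ℝ) - d - 1) := by
  have htrace (c : Fin d → EuclideanSpace ℝ (Fin N)) :
      (S * ((design (colored S c))ᵀ * design (colored S c))⁻¹).trace = ((gram ℝ c)⁻¹).trace := by
    rw [design_colored, gram_eq_transpose_mul_ofColumns,
      ← trace_mul_inv_transpose_mul_self (ofColumns c) (isUnit_det_sqrt hS), transpose_sqrt,
      CFC.sqrt_mul_sqrt_self S hS.posSemidef.nonneg]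
  have hint := integrable_inv_transpose_mul_design_apply hS hN
  rw [← integral_trace_mul hint, ← map_colored_pi_stdGaussian,
    integral_map measurable_colored.aemeasurable]
  · simp only [htrace]
    simpa using integral_trace_inv_gram_stdGaussian (E := EuclideanSpace ℝ (Fin N)) (n := d)
      (by simpa using hN)
  · rw [map_colored_pi_stdGaussian]
    exact (integrable_trace_mul hint S).aestronglyMeasurable

end GaussianDesign

/-! ### Minimisers of the weighted loss -/

section Pool

variable {ι V : Type*} [Fintype ι] [AddCommGroup V] [Module ℝ V]

/-- The average `(a₀ + ∑ₖ λₖ aₖ) / (1 + ∑ₖ λₖ)` of a main and several auxiliary vectors, the main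
one having weight `1`. It is `0` when the total weight `1 + ∑ₖ λₖ` vanishes. -/
noncomputable def pool (lam : ι → ℝ) (a₀ : V) (a : ι → V) : V :=
  (1 + ∑ k, lam k)⁻¹ • (a₀ + ∑ k, lam k • a k)

lemma sub_pool_add_sum {lam : ι → ℝ} (hlam : 1 + ∑ k, lam k ≠ 0) (a₀ : V) (a : ι → V) :
    (pool lam a₀ a - a₀) + ∑ k, lam k • (pool lam a₀ a - a k) = 0 := by
  have h : (1 + ∑ k, lam k) • pool lam a₀ a = a₀ + ∑ k, lam k • a k := smul_inv_smul₀ hlam _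
  simp only [smul_sub, Finset.sum_sub_distrib, ← Finset.sum_smul]
  rw [sub_add_sub_comm, ← h, add_smul, one_smul, sub_self]

lemma pool_sub_eq_smul {lam : ι → ℝ} (hlam : 1 + ∑ k, lam k ≠ 0) (hL : ∑ k, lam k ≠ 0) (a₀ : V)
    (a : ι → V) :
    pool lam a₀ a - a₀ = ((∑ k, lam k) / (1 + ∑ k, lam k)) •
      ((1 / ∑ k, lam k) • (∑ k, lam k • a k) - a₀) := by
  unfold pool
  match_scalars <;> field_simp
  ring

lemma pool_of_forall_eq_zero {lam : ι → ℝ} (hlam : ∀ k, lam k = 0) (a₀ : V) (a : ι → V) :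
    pool lam a₀ a = a₀ := by
  simp [pool, hlam]

lemma norm_sub_sq_add_sum_eq {V : Type*} [NormedAddCommGroup V] [InnerProductSpace ℝ V]
    {lam : ι → ℝ} (hlam : 1 + ∑ k, lam k ≠ 0) (v a₀ : V) (a : ι → V) :
    ‖v - a₀‖ ^ 2 + ∑ k, lam k * ‖v - a k‖ ^ 2 =
      (1 + ∑ k, lam k) * ‖v - pool lam a₀ a‖ ^ 2 +
        (‖pool lam a₀ a - a₀‖ ^ 2 + ∑ k, lam k * ‖pool lam a₀ a - a k‖ ^ 2) := by
  set p := pool lam a₀ a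
  have hsq (y : V) : ‖v - y‖ ^ 2 = ‖v - p‖ ^ 2 + 2 * ⟪v - p, p - y⟫ + ‖p - y‖ ^ 2 := by
    rw [← norm_add_sq_real, sub_add_sub_cancel]
  have hcross : ⟪v - p, p - a₀⟫ + ∑ k, lam k * ⟪v - p, p - a k⟫ = 0 := by
    rw [← inner_zero_right (v - p), ← sub_pool_add_sum hlam a₀ a, inner_add_right, inner_sum]
    simp only [inner_smul_right, p]
  have hterm (k : ι) : lam k * ‖v - a k‖ ^ 2 = lam k * ‖v - p‖ ^ 2 +
      2 * (lam k * ⟪v - p, p - a k⟫) + lam k * ‖p - a k‖ ^ 2 := by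
    rw [hsq (a k)]
    ring
  rw [hsq a₀, Finset.sum_congr rfl fun k _ => hterm k, Finset.sum_add_distrib,
    Finset.sum_add_distrib, ← Finset.sum_mul, ← Finset.mul_sum]
  linear_combination 2 * hcross

end Pool

section LeastSquares

lemma inner_map_sub_map_eq_zero_of_isMinOn {V W : Type*} [AddCommGroup V] [Module ℝ V]
    [NormedAddCommGroup W] [InnerProductSpace ℝ W] {T : V →ₗ[ℝ] W} {w : V} {y : W}
    (hw : IsMinOn (fun v => ‖y - T v‖) Set.univ w) (v : V) : ⟪y - T w, T v⟫ = 0 := by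
  refine (T.range.norm_eq_iInf_iff_real_inner_eq_zero (T.mem_range_self w)).1 ?_ _
    (T.mem_range_self v)
  refine le_antisymm (le_ciInf ?_) (ciInf_le ⟨0, ?_⟩ (⟨T w, T.mem_range_self w⟩ : T.range))
  · rintro ⟨_, u, rfl⟩
    exact hw (Set.mem_univ u)
  · rintro _ ⟨u, rfl⟩
    exact norm_nonneg _

lemma eq_olsMatrix_mulVec_of_isMinOn {m n : Type*} [Fintype m] [Fintype n] [DecidableEq n]
    {A : Matrix m n ℝ} (hA : (Aᵀ * A).det ≠ 0) {y : EuclideanSpace ℝ m} {w : EuclideanSpace ℝ n}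
    (hw : IsMinOn (fun v => ‖y - toEuclideanLin A v‖) Set.univ w) :
    w.ofLp = olsMatrix A *ᵥ y.ofLp := by
  have hnormal : Aᵀ *ᵥ (y.ofLp - A *ᵥ w.ofLp) = 0 := by
    have h := inner_map_sub_map_eq_zero_of_isMinOn hw
      (WithLp.toLp 2 (Aᵀ *ᵥ (y.ofLp - A *ᵥ w.ofLp)))
    rw [real_inner_comm, EuclideanSpace.inner_eq_star_dotProduct] at h
    rw [← dotProduct_self_eq_zero]
    nth_rw 1 [mulVec_transpose]
    rw [← dotProduct_mulVec]
    simpa [toLpLin_apply] using h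
  rw [mulVec_sub, sub_eq_zero, mulVec_mulVec] at hnormal
  rw [olsMatrix, ← mulVec_mulVec, hnormal, mulVec_mulVec,
    nonsing_inv_mul _ (isUnit_iff_ne_zero.2 hA), one_mulVec]

variable {N d K : ℕ} {lam : Fin K → ℝ}

/-- The ordinary least squares estimator `(XᵀX)⁻¹Xᵀy`, where `X` is the matrix with rows `X i`. It
is `0` when `XᵀX` is singular. -/
noncomputable def olsEstimator (X : Fin N → EuclideanSpace ℝ (Fin d)) (y : Fin N → ℝ) :
    EuclideanSpace ℝ (Fin d) :=
  WithLp.toLp 2 (olsMatrix (design X) *ᵥ y)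

lemma isMinOn_norm_pool_sub_predict (hlam : 0 < 1 + ∑ k, lam k) {D : TrainingSet N d K}
    {w : EuclideanSpace ℝ (Fin d)} (hw : IsMinOn (loss lam D) Set.univ w) :
    IsMinOn (fun v => ‖pool lam D.Ym D.Yaux - predict D.X v‖) Set.univ w := fun v _ => by
  have h : loss lam D w ≤ loss lam D v := hw (Set.mem_univ v)
  rw [loss, loss, norm_sub_sq_add_sum_eq hlam.ne', norm_sub_sq_add_sum_eq hlam.ne' (predict D.X v),
    add_le_add_iff_right, mul_le_mul_iff_right₀ hlam, sq_le_sq₀ (norm_nonneg _) (norm_nonneg _),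
    norm_sub_rev, norm_sub_rev (predict D.X v)] at h
  exact h

lemma pool_labels (X : Fin N → EuclideanSpace ℝ (Fin d)) (wm : EuclideanSpace ℝ (Fin d))
    (waux : Fin K → EuclideanSpace ℝ (Fin d)) (εm : Fin N → ℝ) (εaux : Fin K → Fin N → ℝ) :
    pool lam (labels X wm εm) (fun k => labels X (waux k) (εaux k)) =
      labels X (pool lam wm waux) (pool lam εm εaux) := by
  apply WithLp.ofLp_injective
  simp only [pool, labels, predict, WithLp.ofLp_smul, WithLp.ofLp_add, WithLp.ofLp_sum,
    mulVec_smul, mulVec_add, mulVec_sum, smul_add, Finset.sum_add_distrib]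
  abel

lemma eq_pool_add_of_isMinOn_loss_generate (hlam : 0 < 1 + ∑ k, lam k)
    {X : Fin N → EuclideanSpace ℝ (Fin d)} (hX : ((design X)ᵀ * design X).det ≠ 0)
    {wm : EuclideanSpace ℝ (Fin d)} {waux : Fin K → EuclideanSpace ℝ (Fin d)} {εm : Fin N → ℝ}
    {εaux : Fin K → Fin N → ℝ} {w : EuclideanSpace ℝ (Fin d)}
    (hw : IsMinOn (loss lam (generate wm waux X εm εaux)) Set.univ w) :
    w = pool lam wm waux + olsEstimator X (pool lam εm εaux) := by
  have hmin := isMinOn_norm_pool_sub_predict hlam hw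
  simp only [generate, pool_labels] at hmin
  apply WithLp.ofLp_injective
  rw [eq_olsMatrix_mulVec_of_isMinOn hX hmin]
  simp only [labels, predict, olsEstimator, WithLp.ofLp_add, mulVec_add]
  congr 1
  rw [olsMatrix, mulVec_mulVec, Matrix.mul_assoc]
  exact (congrArg (· *ᵥ _) (nonsing_inv_mul _ (isUnit_iff_ne_zero.2 hX))).trans (one_mulVec _)

end LeastSquares

/-! ### White noise and independent random vectors -/

section DotProduct

variable {ι Ω : Type*} [MeasurableSpace Ω] {P : Measure Ω} {u u' v v' : Ω → ι → ℝ}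

lemma memLp_two_mul_of_indepFun {f g : Ω → ℝ} (hf : MemLp f 2 P) (hg : MemLp g 2 P)
    (h : IndepFun f g P) : MemLp (fun ω => f ω * g ω) 2 P := by
  refine (memLp_two_iff_integrable_sq (hf.aestronglyMeasurable.mul hg.aestronglyMeasurable)).2 ?_
  simp_rw [Pi.mul_apply, mul_pow]
  exact (h.comp (φ := fun x => x ^ 2) (ψ := fun x => x ^ 2) (by fun_prop)
    (by fun_prop)).integrable_mul hf.integrable_sq hg.integrable_sq

lemma indepFun_eval (h : IndepFun u v P) (i k : ι) :
    IndepFun (fun ω => u ω i) (fun ω => v ω k) P :=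
  h.comp (measurable_pi_apply i) (measurable_pi_apply k)

variable [Fintype ι]

lemma memLp_two_dotProduct_of_indepFun (hu : ∀ i, MemLp (fun ω => u ω i) 2 P)
    (hv : ∀ i, MemLp (fun ω => v ω i) 2 P) (h : IndepFun u v P) :
    MemLp (fun ω => u ω ⬝ᵥ v ω) 2 P :=
  memLp_finsetSum _ fun i _ => memLp_two_mul_of_indepFun (hu i) (hv i) (indepFun_eval h i i)

lemma integral_dotProduct_of_indepFun (hu : ∀ i, Integrable (fun ω => u ω i) P)
    (hv : ∀ i, Integrable (fun ω => v ω i) P) (h : IndepFun u v P) :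
    ∫ ω, u ω ⬝ᵥ v ω ∂P = ∑ i, (∫ ω, u ω i ∂P) * ∫ ω, v ω i ∂P := by
  have hint (i) : Integrable (fun ω => u ω i * v ω i) P :=
    (indepFun_eval h i i).integrable_mul (hu i) (hv i)
  simp only [dotProduct]
  rw [integral_finsetSum _ fun i _ => hint i]
  exact Finset.sum_congr rfl fun i _ => (indepFun_eval h i i).integral_fun_mul_eq_mul_integral
    (hu i).aestronglyMeasurable (hv i).aestronglyMeasurable

lemma integral_dotProduct_mul_dotProduct_of_indepFun (hu : ∀ i, MemLp (fun ω => u ω i) 2 P)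
    (hu' : ∀ i, MemLp (fun ω => u' ω i) 2 P) (hv : ∀ i, MemLp (fun ω => v ω i) 2 P)
    (hv' : ∀ i, MemLp (fun ω => v' ω i) 2 P)
    (h : IndepFun (fun ω => (u ω, u' ω)) (fun ω => (v ω, v' ω)) P) :
    ∫ ω, u ω ⬝ᵥ v ω * u' ω ⬝ᵥ v' ω ∂P =
      ∑ i, ∑ k, (∫ ω, u ω i * u' ω k ∂P) * ∫ ω, v ω i * v' ω k ∂P := by
  have hind (i k) : IndepFun (fun ω => u ω i * u' ω k) (fun ω => v ω i * v' ω k) P :=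
    h.comp (φ := fun p : (ι → ℝ) × (ι → ℝ) => p.1 i * p.2 k)
      (ψ := fun p : (ι → ℝ) × (ι → ℝ) => p.1 i * p.2 k) (by fun_prop) (by fun_prop)
  have hu_int (i k) : Integrable (fun ω => u ω i * u' ω k) P := (hu i).integrable_mul (hu' k)
  have hv_int (i k) : Integrable (fun ω => v ω i * v' ω k) P := (hv i).integrable_mul (hv' k)
  have hint (i k) : Integrable (fun ω => u ω i * u' ω k * (v ω i * v' ω k)) P :=
    (hind i k).integrable_mul (hu_int i k) (hv_int i k)
  simp only [dotProduct, Finset.sum_mul_sum, mul_mul_mul_comm (_ : ℝ) _ _ (_ : ℝ)]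
  rw [integral_finsetSum _ fun i _ => integrable_finsetSum _ fun k _ => hint i k]
  refine Finset.sum_congr rfl fun i _ => ?_
  rw [integral_finsetSum _ fun k _ => hint i k]
  exact Finset.sum_congr rfl fun k _ => (hind i k).integral_fun_mul_eq_mul_integral
    (hu_int i k).aestronglyMeasurable (hv_int i k).aestronglyMeasurable

end DotProduct

section WhiteNoise

lemma memLp_comp_of_hasLaw {Ω α E : Type*} [MeasurableSpace Ω] [MeasurableSpace α]
    [NormedAddCommGroup E] {P : Measure Ω} {μ : Measure α} {Z : Ω → α} {f : α → E} {p : ENNReal}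
    (hf : MemLp f p μ) (hZ : HasLaw Z μ P) : MemLp (fun ω => f (Z ω)) p P :=
  (memLp_map_measure_iff (hZ.map_eq ▸ hf.aestronglyMeasurable) hZ.aemeasurable).1 (hZ.map_eq ▸ hf)

variable {ι κ Ω : Type*} [DecidableEq ι] [MeasurableSpace Ω] {P : Measure Ω}

/-- White noise of variance `v`: the coordinates of the random vector `ε` are square integrable,
centred, pairwise uncorrelated and have second moment `v`. -/
structure IsWhiteNoise (ε : Ω → ι → ℝ) (v : ℝ) (P : Measure Ω) : Prop where
  memLp (i : ι) : MemLp (fun ω => ε ω i) 2 P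
  integral_eq_zero (i : ι) : ∫ ω, ε ω i ∂P = 0
  integral_mul_eq (i j : ι) : ∫ ω, ε ω i * ε ω j ∂P = if i = j then v else 0

namespace IsWhiteNoise

variable {ε δ : Ω → ι → ℝ} {v w : ℝ}

lemma integrable [IsFiniteMeasure P] (h : IsWhiteNoise ε v P) (i : ι) :
    Integrable (fun ω => ε ω i) P :=
  (h.memLp i).integrable one_le_two

lemma aemeasurable [Countable ι] (h : IsWhiteNoise ε v P) : AEMeasurable ε P :=
  aemeasurable_pi_iff.2 fun i => (h.memLp i).aemeasurable

lemma comp_hasLaw {μ : Measure (ι → ℝ)} (h : IsWhiteNoise id v μ)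
    (hε : HasLaw ε μ P) : IsWhiteNoise ε v P where
  memLp i := memLp_comp_of_hasLaw (h.memLp i) hε
  integral_eq_zero i :=
    (hε.integral_comp (measurable_pi_apply i).aestronglyMeasurable).trans (h.integral_eq_zero i)
  integral_mul_eq i j :=
    (hε.integral_comp ((measurable_pi_apply i).mul
      (measurable_pi_apply j)).aestronglyMeasurable).trans (h.integral_mul_eq i j)

lemma zero : IsWhiteNoise (fun _ => (0 : ι → ℝ)) 0 P where
  memLp _ := by simp
  integral_eq_zero _ := by simp
  integral_mul_eq _ _ := by simp

lemma const_smul (h : IsWhiteNoise ε v P) (c : ℝ) :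
    IsWhiteNoise (fun ω => c • ε ω) (c ^ 2 * v) P where
  memLp i := (h.memLp i).const_mul c
  integral_eq_zero i := by simp [integral_const_mul, h.integral_eq_zero]
  integral_mul_eq i j := by
    simp [mul_mul_mul_comm c, integral_const_mul, h.integral_mul_eq, sq]

lemma add [IsFiniteMeasure P] (h : IsWhiteNoise ε v P) (h' : IsWhiteNoise δ w P)
    (hind : IndepFun ε δ P) : IsWhiteNoise (fun ω => ε ω + δ ω) (v + w) P where
  memLp i := (h.memLp i).add (h'.memLp i)
  integral_eq_zero i := by
    simp [integral_add (h.integrable i) (h'.integrable i), h.integral_eq_zero, h'.integral_eq_zero]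
  integral_mul_eq i j := by
    have hcross (i j) : ∫ ω, ε ω i * δ ω j ∂P = 0 := by
      rw [(indepFun_eval hind i j).integral_fun_mul_eq_mul_integral
        (h.memLp i).aestronglyMeasurable (h'.memLp j).aestronglyMeasurable,
        h.integral_eq_zero, zero_mul]
    have hεε : Integrable (fun ω => ε ω i * ε ω j) P := (h.memLp i).integrable_mul (h.memLp j)
    have hεδ (i j) : Integrable (fun ω => ε ω i * δ ω j) P :=
      (h.memLp i).integrable_mul (h'.memLp j)
    have hδδ : Integrable (fun ω => δ ω i * δ ω j) P := (h'.memLp i).integrable_mul (h'.memLp j)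
    have hexp (ω) : (ε ω + δ ω) i * (ε ω + δ ω) j =
        ε ω i * ε ω j + ε ω i * δ ω j + (ε ω j * δ ω i + δ ω i * δ ω j) := by
      simp only [Pi.add_apply]
      ring
    simp only [hexp]
    rw [integral_add (by exact hεε.add (hεδ i j)) (by exact (hεδ j i).add hδδ),
      integral_add hεε (hεδ i j), integral_add (hεδ j i) hδδ, h.integral_mul_eq,
      h'.integral_mul_eq, hcross, hcross]
    split_ifs <;> ring

lemma sum [Countable ι] [IsFiniteMeasure P] {ε : κ → Ω → ι → ℝ} {v : κ → ℝ}
    (h : ∀ k, IsWhiteNoise (ε k) (v k) P) (hind : iIndepFun ε P) (s : Finset κ) :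
    IsWhiteNoise (fun ω => ∑ k ∈ s, ε k ω) (∑ k ∈ s, v k) P := by
  classical
  induction s using Finset.induction_on with
  | empty => exact zero
  | insert k s hk ih =>
    have hks : IndepFun (fun ω => ∑ l ∈ s, ε l ω) (ε k) P := by
      simpa only [Finset.sum_fn] using
        hind.indepFun_finsetSum_of_notMem₀ (fun l => (h l).aemeasurable) hk
    simp only [Finset.sum_insert hk]
    exact (h k).add ih hks.symm

lemma pool [Countable ι] [Fintype κ] [IsFiniteMeasure P] {ε₀ : Ω → ι → ℝ} {ε : Ω → κ → ι → ℝ}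
    {v₀ : ℝ} {v : κ → ℝ} (h₀ : IsWhiteNoise ε₀ v₀ P)
    (h : ∀ k, IsWhiteNoise (fun ω => ε ω k) (v k) P) (hind₀ : IndepFun ε₀ ε P)
    (hind : iIndepFun (fun k ω => ε ω k) P) (lam : κ → ℝ) :
    IsWhiteNoise (fun ω => AuxOLS.pool lam (ε₀ ω) (ε ω))
      ((v₀ + ∑ k, lam k ^ 2 * v k) / (1 + ∑ k, lam k) ^ 2) P := by
  have hsum : IsWhiteNoise (fun ω => ∑ k, lam k • ε ω k) (∑ k, lam k ^ 2 * v k) P :=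
    IsWhiteNoise.sum (fun k => (h k).const_smul (lam k))
      (hind.comp (fun k x => lam k • x) fun k => by fun_prop) Finset.univ
  have hind' : IndepFun ε₀ (fun ω => ∑ k, lam k • ε ω k) P :=
    hind₀.comp (ψ := fun x : κ → ι → ℝ => ∑ k, lam k • x k) measurable_id (by fun_prop)
  rw [div_eq_inv_mul, ← inv_pow]
  exact (h₀.add hsum hind').const_smul _

end IsWhiteNoise

lemma isWhiteNoise_pi [Fintype ι] {μ : Measure ℝ} [IsProbabilityMeasure μ] {v : ℝ}
    (h2 : MemLp id 2 μ) (h0 : ∫ z, z ∂μ = 0) (hv : ∫ z, z ^ 2 ∂μ = v) :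
    IsWhiteNoise id v (Measure.pi fun _ : ι => μ) := by
  have hmean (i : ι) : ∫ x, x i ∂(Measure.pi fun _ : ι => μ) = 0 := by rw [integral_eval, h0]
  refine ⟨fun i => h2.comp_measurePreserving (measurePreserving_eval (fun _ : ι => μ) i), hmean,
    fun i j => ?_⟩
  split_ifs with hij
  · subst hij
    simp_rw [← sq]
    exact (integral_comp_eval (μ := fun _ : ι => μ) (i := i) (f := fun z : ℝ => z ^ 2)
      (by fun_prop)).trans hv
  · have hind := (iIndepFun_pi (μ := fun _ : ι => μ) (X := fun _ x => x)
      (fun _ => by fun_prop)).indepFun hij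
    simp only [id]
    rw [hind.integral_fun_mul_eq_mul_integral (measurable_pi_apply i).aestronglyMeasurable
      (measurable_pi_apply j).aestronglyMeasurable, hmean, zero_mul]

variable {n : Type*} [Fintype ι] {A : Ω → Matrix n ι ℝ} {η : Ω → ι → ℝ} {v : ℝ}

lemma integral_mulVec_of_isWhiteNoise [IsFiniteMeasure P] (hη : IsWhiteNoise η v P) {j : n}
    (hA : ∀ i, MemLp (fun ω => A ω j i) 2 P) (hind : IndepFun (fun ω => A ω j) η P) :
    ∫ ω, (A ω *ᵥ η ω) j ∂P = 0 := by
  simp only [mulVec]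
  rw [integral_dotProduct_of_indepFun (fun i => (hA i).integrable one_le_two) hη.integrable hind]
  simp only [hη.integral_eq_zero, mul_zero, Finset.sum_const_zero]

lemma integral_mulVec_mul_mulVec_of_isWhiteNoise (hη : IsWhiteNoise η v P) {j k : n}
    (hA : ∀ i, MemLp (fun ω => A ω j i) 2 P) (hA' : ∀ i, MemLp (fun ω => A ω k i) 2 P)
    (hind : IndepFun (fun ω => (A ω j, A ω k)) η P) :
    ∫ ω, (A ω *ᵥ η ω) j * (A ω *ᵥ η ω) k ∂P = v * ∫ ω, (A ω * (A ω)ᵀ) j k ∂P := by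
  simp only [mulVec]
  rw [integral_dotProduct_mul_dotProduct_of_indepFun hA hA' hη.memLp hη.memLp
    (hind.comp measurable_id (measurable_id.prodMk measurable_id))]
  simp only [hη.integral_mul_eq, mul_ite, mul_zero, Finset.sum_ite_eq, Finset.mem_univ, if_true,
    mul_apply, transpose_apply]
  have hint (i) : Integrable (fun ω => A ω j i * A ω k i) P := (hA i).integrable_mul (hA' i)
  rw [integral_finsetSum _ fun i _ => hint i, Finset.mul_sum]
  exact Finset.sum_congr rfl fun i _ => mul_comm _ _

end WhiteNoise

/-! ### Bias–variance decomposition -/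

section BiasVariance

variable {Ω : Type*} [MeasurableSpace Ω] {P : Measure Ω} {d : ℕ} {S : Matrix (Fin d) (Fin d) ℝ}
  {x what u v : Ω → EuclideanSpace ℝ (Fin d)} {e y : Ω → ℝ} {wm : EuclideanSpace ℝ (Fin d)}

/-- The random vector `x` is square integrable and `S = 𝔼 (x xᵀ)`. -/
structure HasSecondMoment (x : Ω → EuclideanSpace ℝ (Fin d)) (S : Matrix (Fin d) (Fin d) ℝ)
    (P : Measure Ω) : Prop where
  memLp : MemLp x 2 P
  integral_mul_eq (j k : Fin d) : ∫ ω, x ω j * x ω k ∂P = S j k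

lemma HasSecondMoment.comp_hasLaw {μ : Measure (EuclideanSpace ℝ (Fin d))}
    (h : HasSecondMoment id S μ) (hx : HasLaw x μ P) : HasSecondMoment x S P where
  memLp := memLp_comp_of_hasLaw (f := id) h.memLp hx
  integral_mul_eq j k :=
    (hx.integral_comp (f := fun x : EuclideanSpace ℝ (Fin d) => x j * x k)
      (by fun_prop)).trans (h.integral_mul_eq j k)

lemma norm_sqrtApply_sq (hS : S.PosSemidef) (v : EuclideanSpace ℝ (Fin d)) :
    ‖sqrtApply S v‖ ^ 2 = ∑ j, ∑ k, S j k * (v j * v k) := by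
  have hdot : ‖sqrtApply S v‖ ^ 2 = CFC.sqrt S *ᵥ v.ofLp ⬝ᵥ CFC.sqrt S *ᵥ v.ofLp := by
    rw [EuclideanSpace.real_norm_sq_eq]
    simp [sqrtApply, dotProduct, sq]
  rw [hdot, dotProduct_mulVec, ← mulVec_transpose, transpose_sqrt, mulVec_mulVec,
    CFC.sqrt_mul_sqrt_self S hS.nonneg, dotProduct]
  simp only [mulVec, dotProduct, Finset.sum_mul]
  exact Finset.sum_congr rfl fun j _ => Finset.sum_congr rfl fun k _ => by ring

lemma norm_sqrtApply_smul_sq (c : ℝ) (w : EuclideanSpace ℝ (Fin d)) :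
    ‖sqrtApply S (c • w)‖ ^ 2 = c ^ 2 * ‖sqrtApply S w‖ ^ 2 := by
  rw [sqrtApply, map_smul, norm_smul, mul_pow, Real.norm_eq_abs, sq_abs, sqrtApply]

lemma real_inner_eq_dotProduct (a b : EuclideanSpace ℝ (Fin d)) : ⟪a, b⟫ = a.ofLp ⬝ᵥ b.ofLp :=
  dotProduct_comm _ _

lemma memLp_two_inner_of_indepFun (hx : MemLp x 2 P) (hu : MemLp u 2 P) (h : IndepFun x u P) :
    MemLp (fun ω => ⟪x ω, u ω⟫) 2 P := by
  simp only [real_inner_eq_dotProduct]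
  exact memLp_two_dotProduct_of_indepFun hx.eval_piLp hu.eval_piLp
    (h.comp (by fun_prop) (by fun_prop))

lemma HasSecondMoment.integral_inner_mul_inner (hx : HasSecondMoment x S P) (hu : MemLp u 2 P)
    (hv : MemLp v 2 P) (h : IndepFun x (fun ω => (u ω, v ω)) P) :
    ∫ ω, ⟪x ω, u ω⟫ * ⟪x ω, v ω⟫ ∂P = ∑ j, ∑ k, S j k * ∫ ω, u ω j * v ω k ∂P := by
  simp only [real_inner_eq_dotProduct, ← hx.integral_mul_eq]
  refine integral_dotProduct_mul_dotProduct_of_indepFun hx.memLp.eval_piLp hx.memLp.eval_piLp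
    hu.eval_piLp hv.eval_piLp ?_
  exact h.comp (φ := fun x => (x.ofLp, x.ofLp)) (ψ := fun p => (p.1.ofLp, p.2.ofLp))
    (by fun_prop) (by fun_prop)

lemma integral_add_sq {f g : Ω → ℝ} (hf : MemLp f 2 P) (hg : MemLp g 2 P)
    (h : ∫ ω, f ω * g ω ∂P = 0) :
    ∫ ω, (f ω + g ω) ^ 2 ∂P = ∫ ω, f ω ^ 2 ∂P + ∫ ω, g ω ^ 2 ∂P := by
  have hfg : Integrable (fun ω => 2 * (f ω * g ω)) P := (hf.integrable_mul hg).const_mul 2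
  simp only [add_sq, mul_assoc]
  rw [integral_add (by exact hf.integrable_sq.add hfg) hg.integrable_sq,
    integral_add hf.integrable_sq hfg, integral_const_mul, h, mul_zero, add_zero]

lemma noiseTerm_eq (hy : ∀ ω, y ω = ⟪x ω, wm⟫ + e ω) :
    noiseTerm P x y wm = ∫ ω, e ω ^ 2 ∂P := by
  simp only [noiseTerm, hy, sub_add_cancel_left, neg_sq]

variable [IsProbabilityMeasure P]

lemma HasSecondMoment.biasTerm_eq (hx : HasSecondMoment x S P) (hS : S.PosSemidef) :
    biasTerm P what x wm = ‖sqrtApply S ((∫ ω, what ω ∂P) - wm)‖ ^ 2 := by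
  simp only [biasTerm, norm_sqrtApply_sq hS, sq]
  rw [hx.integral_inner_mul_inner (memLp_const _) (memLp_const _) (indepFun_const_right _ _)]
  simp

lemma memLp_inner_sub_integral (hx : MemLp x 2 P) (hw : MemLp what 2 P) (h : IndepFun what x P) :
    MemLp (fun ω => ⟪x ω, what ω - ∫ ω', what ω' ∂P⟫) 2 P :=
  memLp_two_inner_of_indepFun hx (hw.sub (memLp_const _))
    (h.symm.comp measurable_id (measurable_id.sub_const _))

lemma HasSecondMoment.varianceTerm_eq (hx : HasSecondMoment x S P) (hw : MemLp what 2 P)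
    (h : IndepFun what x P) :
    varianceTerm P what x = ∑ j, ∑ k, S j k *
      ∫ ω, (what ω - ∫ ω', what ω' ∂P) j * (what ω - ∫ ω', what ω' ∂P) k ∂P := by
  simp only [varianceTerm, sq]
  have hw' : MemLp (fun ω => what ω - ∫ ω', what ω' ∂P) 2 P := hw.sub (memLp_const _)
  exact hx.integral_inner_mul_inner hw' hw' (h.symm.comp measurable_id
    ((measurable_id.sub_const _).prodMk (measurable_id.sub_const _)))

lemma HasSecondMoment.integral_inner_sub_integral_mul_inner_eq_zero (hx : HasSecondMoment x S P)
    (hw : MemLp what 2 P) (h : IndepFun what x P) (b : EuclideanSpace ℝ (Fin d)) :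
    ∫ ω, ⟪x ω, what ω - ∫ ω', what ω' ∂P⟫ * ⟪x ω, b⟫ ∂P = 0 := by
  have hw' : MemLp (fun ω => what ω - ∫ ω', what ω' ∂P) 2 P := hw.sub (memLp_const _)
  have hmean (j : Fin d) : ∫ ω, (what ω - ∫ ω', what ω' ∂P) j ∂P = 0 := by
    rw [← eval_integral_piLp (hw'.integrable one_le_two).eval_piLp,
      integral_sub (hw.integrable one_le_two) (integrable_const _)]
    simp
  rw [hx.integral_inner_mul_inner hw' (memLp_const b)
    (h.symm.comp measurable_id ((measurable_id.sub_const _).prodMk measurable_const))]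
  simp only [integral_mul_const, hmean, zero_mul, mul_zero, Finset.sum_const_zero]

lemma memLp_error (hx : MemLp x 2 P) (hw : MemLp what 2 P) (h : IndepFun what x P)
    (he : MemLp e 2 P) (hy : ∀ ω, y ω = ⟪x ω, wm⟫ + e ω) :
    MemLp (fun ω => ⟪x ω, what ω⟫ - y ω) 2 P := by
  simp only [hy]
  exact (memLp_two_inner_of_indepFun hx hw h.symm).sub
    ((memLp_two_inner_of_indepFun hx (memLp_const wm) (indepFun_const_right _ _)).add he)

theorem HasSecondMoment.genError_eq_variance_add_bias_add_noise (hx : HasSecondMoment x S P)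
    (hw : MemLp what 2 P) (hwx : IndepFun what x P)
    (hwxe : IndepFun (fun ω => (what ω, x ω)) e P) (he : MemLp e 2 P) (he0 : ∫ ω, e ω ∂P = 0)
    (hy : ∀ ω, y ω = ⟪x ω, wm⟫ + e ω) :
    genError P what x y =
      varianceTerm P what x + biasTerm P what x wm + noiseTerm P x y wm := by
  have hvar := memLp_inner_sub_integral hx.memLp hw hwx
  have hbias : MemLp (fun ω => ⟪x ω, (∫ ω', what ω' ∂P) - wm⟫) 2 P :=
    memLp_two_inner_of_indepFun hx.memLp (memLp_const _) (indepFun_const_right _ _)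
  have hsum (ω) : ⟪x ω, what ω - ∫ ω', what ω' ∂P⟫ + ⟪x ω, (∫ ω', what ω' ∂P) - wm⟫ =
      ⟪x ω, what ω - wm⟫ := by
    rw [← inner_add_right, sub_add_sub_cancel]
  have herror : MemLp (fun ω => ⟪x ω, what ω - wm⟫) 2 P :=
    memLp_two_inner_of_indepFun hx.memLp (hw.sub (memLp_const wm))
      (hwx.symm.comp measurable_id (measurable_id.sub_const _))
  have hind : IndepFun (fun ω => ⟪x ω, what ω - wm⟫) e P :=
    hwxe.comp (φ := fun p : EuclideanSpace ℝ (Fin d) × EuclideanSpace ℝ (Fin d) =>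
      ⟪p.2, p.1 - wm⟫) (by fun_prop) measurable_id
  have hcross : ∫ ω, ⟪x ω, what ω - wm⟫ * -e ω ∂P = 0 := by
    simp only [mul_neg]
    rw [integral_neg, hind.integral_fun_mul_eq_mul_integral herror.aestronglyMeasurable
      he.aestronglyMeasurable, he0, mul_zero, neg_zero]
  have herror_sq : genError P what x y = ∫ ω, (⟪x ω, what ω - wm⟫ + -e ω) ^ 2 ∂P := by
    simp only [genError, hy, inner_sub_right, sub_add_eq_sub_sub, ← sub_eq_add_neg]
  rw [herror_sq, integral_add_sq herror (g := fun ω => -e ω) he.neg hcross, noiseTerm_eq hy,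
    varianceTerm, biasTerm, ← integral_add_sq hvar hbias
      (hx.integral_inner_sub_integral_mul_inner_eq_zero hw hwx _)]
  simp only [hsum, neg_sq]

end BiasVariance

/-! ### Least squares with a Gaussian design and white noise -/

section GaussianMoments

lemma isWhiteNoise_pi_gaussianReal {ι : Type*} [Fintype ι] [DecidableEq ι] (v : ℝ≥0) :
    IsWhiteNoise id v (Measure.pi fun _ : ι => gaussianReal 0 v) := by
  have hmean : ∫ z, z ∂gaussianReal 0 v = 0 := integral_id_gaussianReal
  refine isWhiteNoise_pi IsGaussian.memLp_two_id hmean ?_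
  rw [← variance_fun_id_gaussianReal (μ := 0) (v := v),
    variance_of_integral_eq_zero (by fun_prop) hmean]

lemma hasSecondMoment_id_multivariateGaussian {d : ℕ} {S : Matrix (Fin d) (Fin d) ℝ}
    (hS : S.PosSemidef) : HasSecondMoment id S (multivariateGaussian 0 S) := by
  have h2 : MemLp (fun x => x) 2 (multivariateGaussian 0 S) := IsGaussian.memLp_two_id
  have hmean (j : Fin d) : ∫ x, x j ∂(multivariateGaussian 0 S) = 0 := by
    rw [← eval_integral_piLp (h2.integrable one_le_two).eval_piLp,
      integral_id_multivariateGaussian]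
    rfl
  refine ⟨h2, fun j k => ?_⟩
  simp only [id]
  rw [← covariance_eval_multivariateGaussian (μ := 0) hS j k,
    covariance_eq_sub (h2.eval_piLp j) (h2.eval_piLp k)]
  simp [hmean]

end GaussianMoments

section OLSEstimator

variable {Ω : Type*} [MeasurableSpace Ω] {P : Measure Ω} {N d : ℕ} {S : Matrix (Fin d) (Fin d) ℝ}
  {X : Ω → Fin N → EuclideanSpace ℝ (Fin d)} {η : Ω → Fin N → ℝ} {τ : ℝ}

lemma measurable_olsMatrix_design (j : Fin d) :
    Measurable fun X : Fin N → EuclideanSpace ℝ (Fin d) => olsMatrix (design X) j :=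
  measurable_pi_iff.2 fun i => measurable_olsMatrix_apply measurable_design_apply j i

lemma measurable_olsEstimator : Measurable
    fun p : (Fin N → EuclideanSpace ℝ (Fin d)) × (Fin N → ℝ) => olsEstimator p.1 p.2 := by
  have hterm (j i) : Measurable fun p : (Fin N → EuclideanSpace ℝ (Fin d)) × (Fin N → ℝ) =>
      olsMatrix (design p.1) j i * p.2 i :=
    ((measurable_olsMatrix_apply measurable_design_apply j i).comp measurable_fst).mul
      measurable_snd.eval
  exact (WithLp.measurable_toLp 2 _).comp (measurable_pi_iff.2 fun j =>
    Finset.measurable_fun_sum Finset.univ fun i _ => hterm j i)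

lemma memLp_olsMatrix_design_of_hasLaw (hS : S.PosDef) (hN : d + 1 < N)
    (hX : HasLaw X (Measure.pi fun _ => multivariateGaussian 0 S) P) (j : Fin d) (i : Fin N) :
    MemLp (fun ω => olsMatrix (design (X ω)) j i) 2 P :=
  memLp_comp_of_hasLaw (f := fun X => olsMatrix (design X) j i)
    (memLp_olsMatrix_design_apply hS hN j i) hX

lemma memLp_olsEstimator (hS : S.PosDef) (hN : d + 1 < N)
    (hX : HasLaw X (Measure.pi fun _ => multivariateGaussian 0 S) P) (hη : IsWhiteNoise η τ P)
    (hind : IndepFun X η P) : MemLp (fun ω => olsEstimator (X ω) (η ω)) 2 P :=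
  MemLp.of_eval_piLp fun j => memLp_two_dotProduct_of_indepFun
    (memLp_olsMatrix_design_of_hasLaw hS hN hX j) hη.memLp
    (hind.comp (measurable_olsMatrix_design j) measurable_id)

lemma integral_olsEstimator (hS : S.PosDef) (hN : d + 1 < N)
    (hX : HasLaw X (Measure.pi fun _ => multivariateGaussian 0 S) P) (hη : IsWhiteNoise η τ P)
    (hind : IndepFun X η P) : ∫ ω, olsEstimator (X ω) (η ω) ∂P = 0 := by
  have := hX.isProbabilityMeasure
  have hint := (memLp_olsEstimator hS hN hX hη hind).integrable one_le_two
  ext j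
  rw [eval_integral_piLp hint.eval_piLp]
  exact integral_mulVec_of_isWhiteNoise hη
    (memLp_olsMatrix_design_of_hasLaw hS hN hX j)
    (hind.comp (measurable_olsMatrix_design j) measurable_id)

lemma sum_mul_integral_olsEstimator_mul (hS : S.PosDef) (hN : d + 1 < N)
    (hX : HasLaw X (Measure.pi fun _ => multivariateGaussian 0 S) P) (hη : IsWhiteNoise η τ P)
    (hind : IndepFun X η P) :
    ∑ j, ∑ k, S j k * ∫ ω, olsEstimator (X ω) (η ω) j * olsEstimator (X ω) (η ω) k ∂P =
      τ * (d / ((N : ℝ) - d - 1)) := by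
  have hA := memLp_olsMatrix_design_of_hasLaw hS hN hX
  have hcov (j k : Fin d) :
      ∫ ω, olsEstimator (X ω) (η ω) j * olsEstimator (X ω) (η ω) k ∂P =
        τ * ∫ X, ((design X)ᵀ * design X)⁻¹ k j
          ∂(Measure.pi fun _ : Fin N => multivariateGaussian 0 S) := by
    simp only [mul_comm (olsEstimator _ _ j)]
    refine (integral_mulVec_mul_mulVec_of_isWhiteNoise hη (hA k) (hA j) (hind.comp
      ((measurable_olsMatrix_design k).prodMk (measurable_olsMatrix_design j))
      measurable_id)).trans ?_
    simp only [olsMatrix_mul_transpose]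
    congr 1
    exact hX.integral_comp
      (integrable_inv_transpose_mul_design_apply hS hN k j).aestronglyMeasurable
  simp only [hcov, ← sum_mul_integral_inv_transpose_mul_design hS hN, Finset.mul_sum,
    mul_left_comm τ]

end OLSEstimator

/-! ### The multi-task linear model -/

section MultitaskModel

variable {Ω : Type*} [MeasurableSpace Ω] {P : Measure Ω} {N d K : ℕ}
  {S : Matrix (Fin d) (Fin d) ℝ} {vm v : ℝ} {vaux : Fin K → ℝ}
  {X : Ω → Fin N → EuclideanSpace ℝ (Fin d)} {εm : Ω → Fin N → ℝ} {εaux : Ω → Fin K → Fin N → ℝ}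
  {x : Ω → EuclideanSpace ℝ (Fin d)} {e : Ω → ℝ}

/-- The random data of a multi-task linear model: Gaussian features `X` with rows `N(0, S)`, white
label noises `εm` and `εaux k` of variances `vm` and `vaux k`, a fresh feature `x` with second
moment matrix `S`, and a centred fresh noise `e` of variance `v`, where only `X` has a prescribed
law. Independence of `X`, `εm`, the `εaux k`, `x` and `e` is expressed by peeling them off one
group at a time. -/
structure IsMultitaskSample (S : Matrix (Fin d) (Fin d) ℝ) (vm : ℝ) (vaux : Fin K → ℝ) (v : ℝ)
    (X : Ω → Fin N → EuclideanSpace ℝ (Fin d)) (εm : Ω → Fin N → ℝ)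
    (εaux : Ω → Fin K → Fin N → ℝ) (x : Ω → EuclideanSpace ℝ (Fin d)) (e : Ω → ℝ)
    (P : Measure Ω) : Prop where
  hasLaw_features : HasLaw X (Measure.pi fun _ => multivariateGaussian 0 S) P
  isWhiteNoise_main : IsWhiteNoise εm vm P
  isWhiteNoise_aux (k : Fin K) : IsWhiteNoise (fun ω => εaux ω k) (vaux k) P
  hasSecondMoment_fresh : HasSecondMoment x S P
  memLp_fresh_noise : MemLp e 2 P
  integral_fresh_noise : ∫ ω, e ω ∂P = 0
  integral_fresh_noise_sq : ∫ ω, e ω ^ 2 ∂P = v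
  iIndepFun_aux : iIndepFun (fun k ω => εaux ω k) P
  indepFun_main_aux : IndepFun εm εaux P
  indepFun_features_noise : IndepFun X (fun ω => (εm ω, εaux ω)) P
  indepFun_train_fresh : IndepFun (fun ω => (X ω, εm ω, εaux ω)) x P
  indepFun_train_fresh_noise : IndepFun (fun ω => ((X ω, εm ω, εaux ω), x ω)) e P

lemma indepFun_of_hasLaw_prod {α β : Type*} [MeasurableSpace α] [MeasurableSpace β]
    {μ : Measure α} {ν : Measure β} [IsProbabilityMeasure μ] [IsProbabilityMeasure ν]
    {f : Ω → α} {g : Ω → β} (h : HasLaw (fun ω => (f ω, g ω)) (μ.prod ν) P) :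
    HasLaw f μ P ∧ HasLaw g ν P ∧ IndepFun f g P := by
  have := h.isProbabilityMeasure
  have hf : HasLaw f μ P := measurePreserving_fst.fun_comp_hasLaw h
  have hg : HasLaw g ν P := measurePreserving_snd.fun_comp_hasLaw h
  exact ⟨hf, hg, (indepFun_iff_hasLaw_prodMk_prod hf hg).2 h⟩

lemma isMultitaskSample_of_hasLaw_jointLaw (hS : S.PosSemidef) {σm : ℝ≥0}
    {σaux : Fin K → ℝ≥0}
    (h : HasLaw (fun ω => (X ω, εm ω, εaux ω, x ω, e ω)) (jointLaw N S σm σaux) P) :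
    IsMultitaskSample S ((σm : ℝ) ^ 2) (fun k => (σaux k : ℝ) ^ 2) ((σm : ℝ) ^ 2)
      X εm εaux x e P := by
  have hassoc := (measurePreserving_prodAssoc _ _ _).symm.fun_comp_hasLaw h
  have hassoc' := (measurePreserving_prodAssoc _ _ _).symm.fun_comp_hasLaw hassoc
  have hassoc'' := (measurePreserving_prodAssoc _ _ _).symm.fun_comp_hasLaw hassoc'
  obtain ⟨hXεx, he, hXεx_e⟩ := indepFun_of_hasLaw_prod
    (f := fun ω => (((X ω, εm ω), εaux ω), x ω)) (g := e) hassoc''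
  obtain ⟨hXε, hx, hXε_x⟩ := indepFun_of_hasLaw_prod hXεx
  obtain ⟨hX, hε, hX_ε⟩ := indepFun_of_hasLaw_prod (f := X) (g := fun ω => (εm ω, εaux ω))
    ((measurePreserving_prodAssoc _ _ _).fun_comp_hasLaw hXε)
  obtain ⟨hεm, hεaux, hεm_εaux⟩ := indepFun_of_hasLaw_prod hε
  have hεaux_k (k : Fin K) : HasLaw (fun ω => εaux ω k)
      (Measure.pi fun _ : Fin N => gaussianReal 0 (σaux k ^ 2)) P :=
    (measurePreserving_eval _ k).fun_comp_hasLaw hεaux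
  have := he.isProbabilityMeasure
  have he_mean : ∫ ω, e ω ∂P = 0 := he.integral_eq.trans integral_id_gaussianReal
  exact
    { hasLaw_features := hX
      isWhiteNoise_main := by simpa using (isWhiteNoise_pi_gaussianReal (σm ^ 2)).comp_hasLaw hεm
      isWhiteNoise_aux := fun k => by
        simpa using (isWhiteNoise_pi_gaussianReal (σaux k ^ 2)).comp_hasLaw (hεaux_k k)
      hasSecondMoment_fresh := (hasSecondMoment_id_multivariateGaussian hS).comp_hasLaw hx
      memLp_fresh_noise := memLp_comp_of_hasLaw (f := id) IsGaussian.memLp_two_id he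
      integral_fresh_noise := he_mean
      integral_fresh_noise_sq := by
        rw [← variance_of_integral_eq_zero he.aemeasurable he_mean, he.variance_eq,
          variance_id_gaussianReal, NNReal.coe_pow]
      iIndepFun_aux := (iIndepFun_iff_hasLaw_pi_pi hεaux_k).2 hεaux
      indepFun_main_aux := hεm_εaux
      indepFun_features_noise := hX_ε
      indepFun_train_fresh := hXε_x.comp MeasurableEquiv.prodAssoc.measurable measurable_id
      indepFun_train_fresh_noise := hXεx_e.comp
        (MeasurableEquiv.prodAssoc.measurable.prodMap measurable_id) measurable_id }

lemma measurable_pool {ι κ : Type*} [Fintype κ] (lam : κ → ℝ) :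
    Measurable fun p : (ι → ℝ) × (κ → ι → ℝ) => pool lam p.1 p.2 := by
  unfold pool
  fun_prop

namespace IsMultitaskSample

variable {lam : Fin K → ℝ} {w₀ wm : EuclideanSpace ℝ (Fin d)}
  {waux : Fin K → EuclideanSpace ℝ (Fin d)} {what : Ω → EuclideanSpace ℝ (Fin d)}

lemma isWhiteNoise_pool (h : IsMultitaskSample S vm vaux v X εm εaux x e P) (lam : Fin K → ℝ) :
    IsWhiteNoise (fun ω => pool lam (εm ω) (εaux ω))
      ((vm + ∑ k, lam k ^ 2 * vaux k) / (1 + ∑ k, lam k) ^ 2) P :=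
  have := h.hasLaw_features.isProbabilityMeasure
  h.isWhiteNoise_main.pool h.isWhiteNoise_aux h.indepFun_main_aux h.iIndepFun_aux lam

lemma indepFun_features_pool (h : IsMultitaskSample S vm vaux v X εm εaux x e P)
    (lam : Fin K → ℝ) : IndepFun X (fun ω => pool lam (εm ω) (εaux ω)) P :=
  h.indepFun_features_noise.comp measurable_id (measurable_pool lam)

lemma ae_eq_pool_add_olsEstimator (h : IsMultitaskSample S vm vaux v X εm εaux x e P)
    (hS : S.PosDef) (hN : d ≤ N) (hlam : 0 < 1 + ∑ k, lam k)
    (hwhat : ∀ᵐ ω ∂P,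
      IsMinOn (loss lam (generate wm waux (X ω) (εm ω) (εaux ω))) Set.univ (what ω)) :
    what =ᵐ[P] fun ω => pool lam wm waux + olsEstimator (X ω) (pool lam (εm ω) (εaux ω)) := by
  have hdet : ∀ᵐ ω ∂P, ((design (X ω))ᵀ * design (X ω)).det ≠ 0 :=
    ae_of_ae_map h.hasLaw_features.aemeasurable
      (h.hasLaw_features.map_eq ▸ ae_det_transpose_mul_design_ne_zero hS hN)
  filter_upwards [hwhat, hdet] with ω hmin hω
  exact eq_pool_add_of_isMinOn_loss_generate hlam hω hmin

lemma indepFun_estimator_fresh (h : IsMultitaskSample S vm vaux v X εm εaux x e P)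
    (hw : what =ᵐ[P] fun ω => w₀ + olsEstimator (X ω) (pool lam (εm ω) (εaux ω))) :
    IndepFun what x P :=
  (h.indepFun_train_fresh.comp (measurable_const.add (measurable_olsEstimator.comp
    (measurable_fst.prodMk ((measurable_pool lam).comp measurable_snd))))
    measurable_id).congr hw.symm .rfl

lemma indepFun_estimator_fresh_noise (h : IsMultitaskSample S vm vaux v X εm εaux x e P)
    (hw : what =ᵐ[P] fun ω => w₀ + olsEstimator (X ω) (pool lam (εm ω) (εaux ω))) :
    IndepFun (fun ω => (what ω, x ω)) e P :=
  (h.indepFun_train_fresh_noise.comp ((measurable_const.add (measurable_olsEstimator.comp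
    (measurable_fst.prodMk ((measurable_pool lam).comp measurable_snd)))).prodMap measurable_id)
    measurable_id).congr (hw.symm.prodMk .rfl) .rfl

lemma memLp_estimator (h : IsMultitaskSample S vm vaux v X εm εaux x e P) (hS : S.PosDef)
    (hN : d + 1 < N)
    (hw : what =ᵐ[P] fun ω => w₀ + olsEstimator (X ω) (pool lam (εm ω) (εaux ω))) :
    MemLp what 2 P :=
  have := h.hasLaw_features.isProbabilityMeasure
  ((memLp_const w₀).add (memLp_olsEstimator hS hN h.hasLaw_features (h.isWhiteNoise_pool lam)
    (h.indepFun_features_pool lam))).ae_eq hw.symm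

lemma integral_estimator (h : IsMultitaskSample S vm vaux v X εm εaux x e P) (hS : S.PosDef)
    (hN : d + 1 < N)
    (hw : what =ᵐ[P] fun ω => w₀ + olsEstimator (X ω) (pool lam (εm ω) (εaux ω))) :
    ∫ ω, what ω ∂P = w₀ := by
  have := h.hasLaw_features.isProbabilityMeasure
  have hη := h.isWhiteNoise_pool lam
  have hXη := h.indepFun_features_pool lam
  rw [integral_congr_ae hw, integral_add (integrable_const _)
    ((memLp_olsEstimator hS hN h.hasLaw_features hη hXη).integrable one_le_two),
    integral_olsEstimator hS hN h.hasLaw_features hη hXη]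
  simp

lemma varianceTerm_eq (h : IsMultitaskSample S vm vaux v X εm εaux x e P) (hS : S.PosDef)
    (hN : d + 1 < N)
    (hw : what =ᵐ[P] fun ω => w₀ + olsEstimator (X ω) (pool lam (εm ω) (εaux ω))) :
    varianceTerm P what x = (vm + ∑ k, lam k ^ 2 * vaux k) / (1 + ∑ k, lam k) ^ 2 *
      (d / ((N : ℝ) - d - 1)) := by
  have := h.hasLaw_features.isProbabilityMeasure
  rw [h.hasSecondMoment_fresh.varianceTerm_eq (h.memLp_estimator hS hN hw)
    (h.indepFun_estimator_fresh hw), h.integral_estimator hS hN hw,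
    ← sum_mul_integral_olsEstimator_mul hS hN h.hasLaw_features (h.isWhiteNoise_pool lam)
      (h.indepFun_features_pool lam)]
  refine Finset.sum_congr rfl fun j _ => Finset.sum_congr rfl fun k _ => ?_
  congr 1
  refine integral_congr_ae (hw.mono fun ω hω => ?_)
  simp only [hω, add_sub_cancel_left]

end IsMultitaskSample

lemma forall_eq_zero_of_eq_zero_or_sum_eq_zero {lam : Fin K → ℝ} (hlam : ∀ k, 0 ≤ lam k)
    (h : K = 0 ∨ ∑ k, lam k = 0) : ∀ k, lam k = 0 := by
  rcases h with rfl | h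
  · exact fun k => k.elim0
  · simpa [Finset.sum_eq_zero_iff_of_nonneg fun k _ => hlam k] using h

end MultitaskModel

end AuxOLS

theorem theorem3p1_general {Ω : Type*} [MeasurableSpace Ω] {P : Measure Ω}
    {N d K : ℕ} (hN : d + 1 < N) {S : Matrix (Fin d) (Fin d) ℝ} (hS : S.PosDef)
    {wm : EuclideanSpace ℝ (Fin d)} {waux : Fin K → EuclideanSpace ℝ (Fin d)}
    {vm v : ℝ} {vaux : Fin K → ℝ} {lam : Fin K → ℝ} (hlam : 0 < 1 + ∑ k, lam k)
    {X : Ω → Fin N → EuclideanSpace ℝ (Fin d)} {εm : Ω → Fin N → ℝ} {εaux : Ω → Fin K → Fin N → ℝ}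
    {x : Ω → EuclideanSpace ℝ (Fin d)} {e : Ω → ℝ}
    (h : AuxOLS.IsMultitaskSample S vm vaux v X εm εaux x e P)
    {y : Ω → ℝ} (hy : ∀ ω, y ω = ⟪x ω, wm⟫ + e ω)
    {what : Ω → EuclideanSpace ℝ (Fin d)}
    (hwhat : ∀ᵐ ω ∂P, IsMinOn
      (AuxOLS.loss lam (AuxOLS.generate wm waux (X ω) (εm ω) (εaux ω))) Set.univ (what ω))
    {L : ℝ} (hL : L = ∑ k, lam k) :
    Integrable what P ∧
    Integrable (fun ω => (⟪x ω, what ω⟫ - y ω) ^ 2) P ∧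
    Integrable (fun ω => ⟪x ω, what ω - ∫ ω', what ω' ∂P⟫ ^ 2) P ∧
    AuxOLS.genError P what x y =
      AuxOLS.varianceTerm P what x + AuxOLS.biasTerm P what x wm + AuxOLS.noiseTerm P x y wm ∧
    (L ≠ 0 →
      AuxOLS.varianceTerm P what x =
        (vm + ∑ k, lam k ^ 2 * vaux k) / (1 + L) ^ 2 * ((d : ℝ) / ((N : ℝ) - d - 1)) ∧
      AuxOLS.biasTerm P what x wm =
        (L / (1 + L)) ^ 2 *
          ‖AuxOLS.sqrtApply S ((1 / L) • (∑ k, lam k • waux k) - wm)‖ ^ 2 ∧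
      AuxOLS.noiseTerm P x y wm = v ∧
      AuxOLS.genError P what x y =
        (vm + ∑ k, lam k ^ 2 * vaux k) / (1 + L) ^ 2 * ((d : ℝ) / ((N : ℝ) - d - 1)) +
          (L / (1 + L)) ^ 2 *
            ‖AuxOLS.sqrtApply S ((1 / L) • (∑ k, lam k • waux k) - wm)‖ ^ 2 +
          v) ∧
    ((∀ k, lam k = 0) →
      AuxOLS.varianceTerm P what x = vm * ((d : ℝ) / ((N : ℝ) - d - 1)) ∧
      AuxOLS.biasTerm P what x wm = 0 ∧
      AuxOLS.noiseTerm P x y wm = v ∧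
      AuxOLS.genError P what x y = vm * ((d : ℝ) / ((N : ℝ) - d - 1)) + v) := by
  subst hL
  have := h.hasLaw_features.isProbabilityMeasure
  have hw := h.ae_eq_pool_add_olsEstimator hS (by lia) hlam hwhat
  have hwL := h.memLp_estimator hS hN hw
  have hwx := h.indepFun_estimator_fresh hw
  have hx := h.hasSecondMoment_fresh
  have he := h.memLp_fresh_noise
  have hdecomp := hx.genError_eq_variance_add_bias_add_noise hwL hwx
    (h.indepFun_estimator_fresh_noise hw) he h.integral_fresh_noise hy
  have hvar := h.varianceTerm_eq hS hN hw
  have hbias := hx.biasTerm_eq (what := what) (wm := wm) hS.posSemidef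
  have hnoise := (AuxOLS.noiseTerm_eq hy).trans h.integral_fresh_noise_sq
  rw [h.integral_estimator hS hN hw] at hbias
  refine ⟨hwL.integrable one_le_two, (AuxOLS.memLp_error hx.memLp hwL hwx he hy).integrable_sq,
    (AuxOLS.memLp_inner_sub_integral hx.memLp hwL hwx).integrable_sq, hdecomp,
    fun hL => ?_, fun hlam0 => ?_⟩
  · rw [AuxOLS.pool_sub_eq_smul hlam.ne' hL, AuxOLS.norm_sqrtApply_smul_sq] at hbias
    exact ⟨hvar, hbias, hnoise, by rw [hdecomp, hvar, hbias, hnoise]⟩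
  · replace hvar : AuxOLS.varianceTerm P what x = vm * (d / ((N : ℝ) - d - 1)) := by
      simpa [hlam0] using hvar
    replace hbias : AuxOLS.biasTerm P what x wm = 0 := by
      simpa [AuxOLS.pool_of_forall_eq_zero hlam0, AuxOLS.sqrtApply] using hbias
    exact ⟨hvar, hbias, hnoise, by rw [hdecomp, hvar, hbias, hnoise, add_zero]⟩

theorem theorem3p1 {Ω : Type*} [MeasurableSpace Ω] (P : Measure Ω) [IsProbabilityMeasure P]
    (N d K : ℕ) (hN : d + 1 < N)
    (S : Matrix (Fin d) (Fin d) ℝ) (hS : S.PosDef)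
    (wm : EuclideanSpace ℝ (Fin d)) (waux : Fin K → EuclideanSpace ℝ (Fin d))
    (σm : ℝ≥0) (σaux : Fin K → ℝ≥0)
    (lam : Fin K → ℝ) (hlam : ∀ k, 0 ≤ lam k)
    -- features, label noises, fresh feature and fresh noise
    (X : Ω → Fin N → EuclideanSpace ℝ (Fin d))
    (εm : Ω → Fin N → ℝ) (εaux : Ω → Fin K → Fin N → ℝ)
    (x : Ω → EuclideanSpace ℝ (Fin d)) (e : Ω → ℝ)
    (hlaw : HasLaw (fun ω => (X ω, εm ω, εaux ω, x ω, e ω)) (AuxOLS.jointLaw N S σm σaux) P)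
    -- the fresh main-task label
    (y : Ω → ℝ) (hy : ∀ ω, y ω = ⟪x ω, wm⟫ + e ω)
    -- the estimator almost surely minimizes the weighted loss of the training set
    (what : Ω → EuclideanSpace ℝ (Fin d))
    (hwhat : ∀ᵐ ω ∂P, IsMinOn
      (AuxOLS.loss lam (AuxOLS.generate wm waux (X ω) (εm ω) (εaux ω))) Set.univ (what ω))
    (L : ℝ) (hL : L = ∑ k, lam k) :
    Integrable what P ∧
    Integrable (fun ω => (⟪x ω, what ω⟫ - y ω) ^ 2) P ∧
    Integrable (fun ω => ⟪x ω, what ω - ∫ ω', what ω' ∂P⟫ ^ 2) P ∧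
    AuxOLS.genError P what x y =
      AuxOLS.varianceTerm P what x + AuxOLS.biasTerm P what x wm + AuxOLS.noiseTerm P x y wm ∧
    (0 < L →
      AuxOLS.varianceTerm P what x =
        ((σm : ℝ) ^ 2 + ∑ k, lam k ^ 2 * (σaux k : ℝ) ^ 2) / (1 + L) ^ 2 *
          ((d : ℝ) / ((N : ℝ) - d - 1)) ∧
      AuxOLS.biasTerm P what x wm =
        (L / (1 + L)) ^ 2 *
          ‖AuxOLS.sqrtApply S ((1 / L) • (∑ k, lam k • waux k) - wm)‖ ^ 2 ∧
      AuxOLS.noiseTerm P x y wm = (σm : ℝ) ^ 2 ∧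
      AuxOLS.genError P what x y =
        ((σm : ℝ) ^ 2 + ∑ k, lam k ^ 2 * (σaux k : ℝ) ^ 2) / (1 + L) ^ 2 *
            ((d : ℝ) / ((N : ℝ) - d - 1)) +
          (L / (1 + L)) ^ 2 *
            ‖AuxOLS.sqrtApply S ((1 / L) • (∑ k, lam k • waux k) - wm)‖ ^ 2 +
          (σm : ℝ) ^ 2) ∧
    (K = 0 ∨ L = 0 →
      AuxOLS.varianceTerm P what x = (σm : ℝ) ^ 2 * ((d : ℝ) / ((N : ℝ) - d - 1)) ∧
      AuxOLS.biasTerm P what x wm = 0 ∧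
      AuxOLS.noiseTerm P x y wm = (σm : ℝ) ^ 2 ∧
      AuxOLS.genError P what x y =
        (σm : ℝ) ^ 2 * ((d : ℝ) / ((N : ℝ) - d - 1)) + (σm : ℝ) ^ 2) := by
  have hsum : 0 ≤ ∑ k, lam k := Finset.sum_nonneg fun k _ => hlam k
  obtain ⟨hw, herr, hvar, hdecomp, haux, hmain⟩ := theorem3p1_general hN hS (by positivity)
    (AuxOLS.isMultitaskSample_of_hasLaw_jointLaw hS.posSemidef hlaw) hy hwhat hL
  exact ⟨hw, herr, hvar, hdecomp, fun hL0 => haux hL0.ne', fun h0 => hmain <|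
    AuxOLS.forall_eq_zero_of_eq_zero_or_sum_eq_zero hlam (hL ▸ h0)⟩
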